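/- **Setting.** Let $\mathcal S,\mathcal A,\mathcal R$ be finite sets of states, actions and rewards, $S=|\mathcal S|$, $A=|\mathcal A|$. A latent MDP $\theta=(w_m,T_m,R_m)_{m=1}^M$ with horizon $H$ draws a context $m$ with probability $w_m$ at the start of an episode; then $s_1$ is drawn from the initial law $T_m(\cdot\mid\emptyset)$ and, for $t=1,\dots,H$, the reward $r_t\sim R_m(\cdot\mid s_t,a_t)$ and the next state $s_{t+1}\sim T_m(\cdot\mid s_t,a_t)$. Let $\mathcal T=(s_t,a_t,r_t)_{t=1}^H$ be the trajectory, $\mathbb P^\pi_\theta$ its law under a policy $\pi$, and $\mathrm{TV}(P,Q)=\sum_{\mathcal T}|P(\mathcal T)-Q(\mathcal T)|$. Assume $H>2M$ and put $d=2M-1$. A memoryless policy chooses the law of $a_t$ from $(s_t,t)$ only; $\mathrm{Unif}(\mathcal A)$ is the uniformly random policy. Let $\mathrm{SubSeq}(H,d)$ be the set of $\tau=(\tau_1<\dots<\tau_q)$ in $\{1,\dots,H\}$ with $1\le q\le d$. For policies $\boldsymbol\psi=(\psi_0,\dots,\psi_d)$, $\tau\in\mathrm{SubSeq}(H,d)$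 and $z\in\{0,1\}^{q}$, the segmented policy $\nu(\boldsymbol\psi;\tau,z)$ executes $\psi_i$ at the times $t$ with $\tau_i<t\le\tau_{i+1}$ (where $\tau_0=0$, $\tau_{q+1}=H$), except that at each $\tau_i$ with $z_i=1$ the action is uniformly random. **Algorithm (LMDP-OMLE).** Let $\Theta$ be a finite class of latent MDPs with $M$ contexts (on the same spaces and with the same horizon) that contains the true model $\theta^*$, let $K\ge1$ and $n_{\rm test}$ be integers, $\epsilon_{\rm test},\eta>0$, and $\beta=\log(K|\Theta|/\eta)$. For a dataset $\mathcal D$ of executed policies with the trajectories they generated, let $$\mathcal C(\mathcal D)=\Big\{\theta\in\Theta:\ \sum_{(\mathcal T,\pi)\in\mathcal D}\log\mathbb P_\theta^\pi(\mathcal T)\ \ge\ \max_{\theta'\in\Theta}\sum_{(\mathcal T,\pi)\in\mathcal D}\log\mathbb P_{\theta'}^\pi(\mathcal T)-\beta\Big\},\qquad \log 0=-\infty .$$ Put $\Psi^0_{\rm test}=\{\mathrm{Unif}(\mathcal A)\}$, let $\mathcal D^0$ consist of $n_{\rm test}$ episodes of $\mathrm{Unif}(\mathcal A)$ in $\theta^*$,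 and let $\mathcal C^1=\mathcal C(\mathcal D^0)$. For $k=1,2,\dots$, as long as there are a memoryless policy $\pi^k$ and $\theta_1,\theta_2\in\mathcal C^k$ with $\mathrm{TV}(\mathbb P^{\pi^k}_{\theta_1},\mathbb P^{\pi^k}_{\theta_2})>4\epsilon_{\rm test}$: pick such a $\pi^k$ (by any rule, possibly randomized, that uses the past policies and data); put $\Psi^k_{\rm test}=\Psi^{k-1}_{\rm test}\cup\{\pi^k\}$; for every $(\psi_0,\dots,\psi_{d-1})\in(\Psi^k_{\rm test})^d$ with at least one $\psi_i=\pi^k$, every $\tau\in\mathrm{SubSeq}(H,d)$ and every $z\in\{0,1\}^{|\tau|}$, execute $\nu((\psi_0,\dots,\psi_{d-1},\mathrm{Unif}(\mathcal A));\tau,z)$ in $\theta^*$ for $n_{\rm test}$ independent episodes; add all these data to $\mathcal D^{k-1}$ to obtain $\mathcal D^k$, and let $\mathcal C^{k+1}=\mathcal C(\mathcal D^k)$. When there is no such $\pi^k$, stop. **Lemma.** Suppose that $$n_{\rm test}\ \ge\ \frac{3\beta M^2\,(8H^2)^d\,(MS^2A^2)^d}{\epsilon_{\rm test}^2}.$$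 Then with probability at least $1-\eta$, at every iteration $k$ executed by the algorithm there are a context $m$, integers $0\le t_1<t_2\le H$ and states $s,s'$ such that $P_m^{\pi^k}(s_{t_1+1}=s')>0$ and $$P_m^{\pi^k}(s_{t_2}=s\mid s_{t_1}'=s')\ >\ 2\max_{\psi\in\Psi_{\rm test}^{k-1}}P_m^{\psi}(s_{t_2}=s\mid s_{t_1}'=s').$$ Here $P_m^\psi$ is the law under $\psi$ in context $m$ of the true model $\theta^*$, $s'_{t_1}=s_{t_1+1}$, and $P_m^{\psi}(s_{t_2}=s\mid s'_{t_1}=s')$ is the probability of $s_{t_2}=s$ when the process in context $m$ is run with $\psi$ from the state $s'$ at time $t_1+1$. -/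

import Mathlib

open scoped ENNReal BigOperators

/-! ### Latent Markov decision processes -/

/-- A latent MDP with `M` contexts on a state space `S`, action space `A` and reward space `R`.
The context `m` is drawn with probability `w m` at the beginning of an episode.
`T m (some (s, a))` is the law of the next state after the pair `(s, a)` in context `m`, and `T m none`
is the law of the initial state (`none` is the null state-action pair preceding time `1`).
`rew m s a` is the law of the reward. -/
structure LMDP (S A R : Type*) (M : ℕ) where
  w : PMF (Fin M)
  T : Fin M → Option (S × A) → PMF S
  rew : Fin M → S → A → PMF R

/-- A (stochastic, time dependent) memoryless policy for horizon `H`. The index `t : Fin H` stands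
for the time step `t + 1`. -/
abbrev Policy (S A : Type*) (H : ℕ) := Fin H → S → PMF A

/-- A trajectory `(s, a, r)` at the time steps `1, …, H`; the index `t : Fin H` stands for the time
step `t + 1`. -/
abbrev Trajectory (S A R : Type*) (H : ℕ) := Fin H → S × A × R

/-- The entry of `x` just before index `t`, and `o` before the first one. -/
def prevEntry {X : Type*} {n : ℕ} (o : Option X) (x : Fin n → X) (t : Fin n) : Option X :=
  if h : (t : ℕ) = 0 then o else some (x ⟨t - 1, by omega⟩)

/-- Products of Markov transition probabilities sum to one. -/
theorem sum_prod_chain {X : Type*} [Fintype X] : ∀ {n : ℕ} (o : Option X)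
    (f : Fin n → Option X → X → ℝ≥0∞) (_ : ∀ t o, ∑ y, f t o y = 1),
    ∑ x : Fin n → X, ∏ t, f t (prevEntry o x t) (x t) = 1 := by
  intro n
  induction n with
  | zero => intro o f _; simp
  | succ n ih =>
    intro o f hf
    rw [← (Fin.consEquiv (fun _ : Fin (n + 1) => X)).sum_comp, Fintype.sum_prod_type]
    have h : ∀ (y : X) (x : Fin n → X),
        (∏ t, f t (prevEntry o (Fin.cons y x : Fin (n + 1) → X) t)
          ((Fin.cons y x : Fin (n + 1) → X) t))
        = f 0 o y * ∏ t : Fin n, f t.succ (prevEntry (some y) x t) (x t) := by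
      intro y x
      rw [Fin.prod_univ_succ]
      congr 1
      refine Finset.prod_congr rfl fun t _ => ?_
      rw [Fin.cons_succ]
      congr 1
      rcases t with ⟨_ | t, ht⟩
      · simp only [prevEntry, Fin.succ_mk]
        rfl
      · simp only [prevEntry, Fin.succ_mk]
        rfl
    simp only [Fin.consEquiv, Equiv.coe_fn_mk, h]
    simp only [← Finset.mul_sum]
    have h2 : ∀ y : X,
        ∑ x : Fin n → X, ∏ t : Fin n, f t.succ (prevEntry (some y) x t) (x t) = 1 :=
      fun y => ih (some y) (fun t => f t.succ) (fun t o => hf _ _)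
    simp [h2, hf]

theorem sum_pmf {X : Type*} [Fintype X] (p : PMF X) : ∑ x, p x = 1 := by
  rw [← tsum_fintype (L := .unconditional X)]
  exact p.tsum_coe

section Model

variable {S A R : Type*} [Fintype S] [Fintype A] [Fintype R] {M H : ℕ}

/-- The probability `P_m^π (s_t, a_t, r_t | s_{t-1}, a_{t-1})` of one step in context `m`. -/
noncomputable def LMDP.stepProb (θ : LMDP S A R M) (m : Fin M) (π : Policy S A H) (t : Fin H)
    (o : Option (S × A × R)) (y : S × A × R) : ℝ≥0∞ :=
  θ.T m (o.map fun z => (z.1, z.2.1)) y.1 * π t y.1 y.2.1 * θ.rew m y.1 y.2.1 y.2.2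

/-- `P_m^π (𝒯)`: the law of the trajectory under the policy `π` in context `m`. -/
noncomputable def LMDP.contextLaw (θ : LMDP S A R M) (m : Fin M) (π : Policy S A H) :
    PMF (Trajectory S A R H) :=
  PMF.ofFintype (fun x => ∏ t, θ.stepProb m π t (prevEntry none x t) (x t))
    (sum_prod_chain none (θ.stepProb m π) fun t o => by
      simp only [LMDP.stepProb, Fintype.sum_prod_type, ← Finset.mul_sum, sum_pmf, mul_one])

/-- `ℙ_θ^π (𝒯)`: the law of the trajectory under the policy `π` in the latent MDP `θ`. -/
noncomputable def LMDP.law (θ : LMDP S A R M) (π : Policy S A H) : PMF (Trajectory S A R H) :=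
  θ.w.bind fun m => θ.contextLaw m π

/-- The law, in context `m` under `π`, of the state `n` steps after the time step `t₁ + 1`, when the
state at time step `t₁ + 1` is `s'`. -/
noncomputable def LMDP.stateFrom (θ : LMDP S A R M) (m : Fin M) (π : Policy S A H) (t₁ : ℕ)
    (s' : S) : ℕ → PMF S
  | 0 => PMF.pure s'
  | n + 1 => (θ.stateFrom m π t₁ s' n).bind fun s =>
      if h : t₁ + n < H then (π ⟨t₁ + n, h⟩ s).bind fun a => θ.T m (some (s, a)) else PMF.pure s

/-- The segment probability `P_m^π (s_{t₂} = s | s'_{t₁} = s')`, for `0 ≤ t₁ < t₂ ≤ H`, where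
`s'_{t₁} = s_{t₁+1}` is the state following time step `t₁` (for `t₁ = 0`, the initial state `s_1`).
For a memoryless policy this is a product of Markov kernels, so that it makes sense also for a
state `s'` that `π` does not visit at time step `t₁ + 1`. -/
noncomputable def LMDP.segProb (θ : LMDP S A R M) (m : Fin M) (π : Policy S A H) (t₁ t₂ : ℕ)
    (s' s : S) : ℝ≥0∞ :=
  θ.stateFrom m π t₁ s' (t₂ - (t₁ + 1)) s

/-- `P_m^π (s_{t+1} = s)`: probability of visiting `s` at time step `t + 1` (index `t`). -/
noncomputable def LMDP.visitProb (θ : LMDP S A R M) (m : Fin M) (π : Policy S A H) (t : Fin H)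
    (s : S) : ℝ≥0∞ :=
  (θ.contextLaw m π).toOuterMeasure {x | (x t).1 = s}

/-- Total variation distance, in the normalization `∑ |p - q|` (without the factor `1/2`). -/
noncomputable def tvDist {X : Type*} [Fintype X] (p q : PMF X) : ℝ :=
  ∑ x, |(p x).toReal - (q x).toReal|

/-! ### Segmented policies -/

/-- The uniformly random policy. -/
noncomputable def unifPolicy [Nonempty A] : Policy S A H := fun _ _ => PMF.uniformOfFintype A

/-- The nonempty increasing sequences `τ` of at most `d` time steps in `1, …, H`, encoded by their
sets of entries. -/
abbrev SubSeq (H d : ℕ) := {τ : Finset (Fin H) // τ.Nonempty ∧ τ.card ≤ d}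

/-- Checkpoints `τ` together with the binary sequence `z` indexed by the checkpoints. -/
abbrev Switching (H d : ℕ) := Σ τ : SubSeq H d, (↥τ.1 → Bool)

/-- The segmented policy `ν(ψ; τ, z)`: the policy `ψ i` is executed at the times `t` with
`τ_i < t ≤ τ_{i+1}`, i.e. with `i` checkpoints before `t`, except that the action at a checkpoint
`t` is uniformly random if its bit in `z` is one. -/
noncomputable def segmented [Nonempty A] {d : ℕ} (ψ : Fin (d + 1) → Policy S A H)
    (c : Switching H d) : Policy S A H := fun t =>
  if ∃ h : t ∈ c.1.1, c.2 ⟨t, h⟩ = true then fun _ => PMF.uniformOfFintype A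
  else ψ ⟨(c.1.1.filter (· < t)).card,
    Nat.lt_succ_of_le ((Finset.card_filter_le _ _).trans c.1.2.2)⟩ t

/-! ### The algorithm -/

/-- A dataset: pairs of an executed policy and the trajectory it generated. -/
abbrev Dataset (S A R : Type*) (H : ℕ) := List (Policy S A H × Trajectory S A R H)

/-- Log-likelihood `∑ log ℙ_θ^π (𝒯)` of a dataset, with `log 0 = -∞`. -/
noncomputable def LMDP.logLik (θ : LMDP S A R M) (D : Dataset S A R H) : EReal :=
  (D.map fun p => ENNReal.log (θ.law p.1 p.2)).sum

/-- The confidence set `{θ ∈ Θ | ∑ log ℙ_θ ≥ max_{θ' ∈ Θ} ∑ log ℙ_θ' - β}`. -/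
def confSet (Θ : Finset (LMDP S A R M)) (β : ℝ) (D : Dataset S A R H) : Set (LMDP S A R M) :=
  {θ | θ ∈ Θ ∧ Θ.sup (fun θ' => θ'.logLik D) - (β : EReal) ≤ θ.logLik D}

/-- State of the algorithm: the test policies `π^1, π^2, …` chosen so far, in this order, and the
data collected so far. -/
structure RunState (S A R : Type*) (H : ℕ) where
  chosen : List (Policy S A H)
  data : Dataset S A R H

/-- While-loop condition for the policy `π`: two models of the confidence set disagree on `π`. -/
def IsDistinguishing (Θ : Finset (LMDP S A R M)) (β ε : ℝ) (σ : RunState S A R H)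
    (π : Policy S A H) : Prop :=
  ∃ θ₁ ∈ confSet Θ β σ.data, ∃ θ₂ ∈ confSet Θ β σ.data, 4 * ε < tvDist (θ₁.law π) (θ₂.law π)

/-- A (possibly randomized) rule by which the algorithm picks, whenever the while-loop condition
holds for some memoryless policy, a policy for which it holds. The pick may depend on everything
the algorithm has seen. -/
def IsSelectionRule (Θ : Finset (LMDP S A R M)) (β ε : ℝ)
    (sel : RunState S A R H → PMF (Policy S A H)) : Prop :=
  ∀ σ, (∃ π, IsDistinguishing Θ β ε σ π) → ∀ π ∈ (sel σ).support, IsDistinguishing Θ β ε σ π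

/-- Execute the listed policies one after the other in the latent MDP `θ`, one independent episode
each, and return the generated data. -/
noncomputable def execute (θ : LMDP S A R M) : List (Policy S A H) → PMF (Dataset S A R H)
  | [] => PMF.pure []
  | π :: l => (θ.law π).bind fun x => (execute θ l).map fun D => (π, x) :: D

open Classical in
/-- The set of test policies `{Unif(A), π^1, …, π^j}` for `l = [π^1, …, π^j]`. -/
noncomputable def testSet [Nonempty A] (l : List (Policy S A H)) : Finset (Policy S A H) :=
  insert unifPolicy l.toFinset

open Classical in
/-- The pairs of `(ψ_0, …, ψ_{d-1}) ∈ Ψ^d` with at least one `ψ_i = π`, and `(τ, z)`. -/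
noncomputable def queries (d : ℕ) (Ψ : Finset (Policy S A H)) (π : Policy S A H) :
    Finset ((Fin d → Policy S A H) × Switching H d) :=
  (Fintype.piFinset fun _ => Ψ).filter (fun ψ => ∃ i, ψ i = π) ×ˢ Finset.univ

/-- The policies executed in one iteration: `ν((ψ_0, …, ψ_{d-1}, Unif(A)); τ, z)`, `n` times for
each of the queries. -/
noncomputable def plan [Nonempty A] (d n : ℕ) (Ψ : Finset (Policy S A H)) (π : Policy S A H) :
    List (Policy S A H) :=
  (queries d Ψ π).toList.flatMap fun q =>
    List.replicate n (segmented (Fin.snoc q.1 unifPolicy) q.2)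

open Classical in
/-- One pass through the while-loop in the true model `θ`; a run whose loop condition fails has
terminated and keeps its state. -/
noncomputable def iterate [Nonempty A] (θ : LMDP S A R M) (Θ : Finset (LMDP S A R M)) (d n : ℕ)
    (β ε : ℝ) (sel : RunState S A R H → PMF (Policy S A H)) (σ : RunState S A R H) :
    PMF (RunState S A R H) :=
  if ∃ π, IsDistinguishing Θ β ε σ π then
    (sel σ).bind fun π =>
      (execute θ (plan d n (testSet (σ.chosen ++ [π])) π)).map fun D =>
        ⟨σ.chosen ++ [π], σ.data ++ D⟩
  else PMF.pure σ

/-- The law of the state of the algorithm, interacting with the true model `θ`, after `N` passes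
through the while-loop (or at termination, if that is earlier). It starts with `n` episodes of the
uniformly random policy. -/
noncomputable def runLaw [Nonempty A] (θ : LMDP S A R M) (Θ : Finset (LMDP S A R M)) (d n : ℕ)
    (β ε : ℝ) (sel : RunState S A R H → PMF (Policy S A H)) : ℕ → PMF (RunState S A R H)
  | 0 => (execute θ (List.replicate n unifPolicy)).map fun D => ⟨[], D⟩
  | N + 1 => (runLaw θ Θ d n β ε sel N).bind (iterate θ Θ d n β ε sel)

/-- Coverage doubling by `π`: for some context `m` and segment `(t₁, t₂, s, s')` which `π` enters
with positive probability, `P_m^π (s_{t₂} = s | s'_{t₁} = s')` is more than twice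
`max_{ψ ∈ Ψ} P_m^ψ (s_{t₂} = s | s'_{t₁} = s')`. -/
def DoublesCoverage (θ : LMDP S A R M) (Ψ : Finset (Policy S A H)) (π : Policy S A H) : Prop :=
  ∃ (m : Fin M) (t₁ : Fin H) (t₂ : ℕ) (s s' : S), (t₁ : ℕ) < t₂ ∧ t₂ ≤ H ∧
    0 < θ.visitProb m π t₁ s' ∧
    2 * Ψ.sup (fun ψ => θ.segProb m ψ t₁ t₂ s' s) < θ.segProb m π t₁ t₂ s' s

end Model

/-!
Compare two models, their contexts with positive and negative mixture weights. If `π` does not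
double the coverage, then every segment which `π` visits has at most twice its probability under
some test policy. Such test-policy probabilities, passed on along a trajectory by the largest
scalars which every context can afford, form a gauge; what is left over at a time step is a signed
mixture in which one context, the one where the gauge is tight, has dropped out. After at most
`2M - 1` checkpoints a single context remains, and the positive part of a mixture of one context
does not depend on the policy. Hence the TV distance under `π` is bounded by a weighted sum of the
TV distances under segmented policies: each gauge becomes the segment of a test policy, and the
action at a checkpoint becomes random at the cost of a factor `A`. The Cauchy–Schwarz inequality
turns this into a bound by squared TV distances under the executed policies.

The squared TV distance is at most `8 (1 - ρ)`, where `ρ` is the affinity (Bhattacharyya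
coefficient). For each model of the class, the product over the episodes of the square roots of the
likelihood ratios, divided by their affinities, is a supermartingale. As long as all these products
are small, every model of the confidence set is close to the true model in total squared TV distance
over the data, which contradicts a distance above `2 ε` under a policy that does not double the
coverage.
-/

/-! ### Positive parts of signed mixtures -/

section Transport

variable {S A R B J : Type*} [Fintype S] [Fintype A] [Fintype R]

open Classical in
/-- The total weight of the paths from `s'` to `s` in `n` steps, where step `i` from `s` to `s''`
with action `a` and reward `r` has the weight `f i s a (r, s'')`. The weights are numbers, or
vectors of numbers with one entry for each context. -/
noncomputable def transport [Semiring B] (f : ℕ → S → A → R × S → B) (s' : S) : ℕ → S → B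
  | 0, s => if s = s' then 1 else 0
  | n + 1, s'' => ∑ s, transport f s' n s * ∑ a, ∑ r, f n s a (r, s'')

section Semiring

variable [Semiring B]

theorem sum_transport_zero_mul (f : ℕ → S → A → R × S → B) (s' : S) (g : S → B) :
    ∑ s, transport f s' 0 s * g s = g s' := by
  classical
  simp only [transport, ite_mul, one_mul, zero_mul, Finset.sum_ite_eq', Finset.mem_univ, if_true]

theorem sum_transport_mul_sum (f : ℕ → S → A → R × S → B) (s' : S) (n : ℕ) (g : S → B) :
    ∑ s, transport f s' n s * ∑ a, ∑ o : R × S, f n s a o * g o.2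
      = ∑ s, transport f s' (n + 1) s * g s := by
  simp only [transport, Fintype.sum_prod_type, Finset.sum_mul, Finset.mul_sum]
  conv_rhs => rw [Finset.sum_comm]
  refine Finset.sum_congr rfl fun s _ => ?_
  conv_rhs => rw [Finset.sum_comm]
  refine Finset.sum_congr rfl fun a _ => ?_
  conv_rhs => rw [Finset.sum_comm]
  simp only [mul_assoc]

theorem transport_congr {f g : ℕ → S → A → R × S → B} (s' : S) :
    ∀ (n : ℕ) (s : S), (∀ i < n, f i = g i) → transport f s' n s = transport g s' n s
  | 0, _, _ => rfl
  | n + 1, s, h => by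
    simp only [transport, h n n.lt_succ_self]
    exact Finset.sum_congr rfl fun s _ => by
      rw [transport_congr s' n s fun i hi => h i (hi.trans n.lt_succ_self)]

theorem transport_nonneg [PartialOrder B] [IsOrderedRing B] {f : ℕ → S → A → R × S → B}
    (hf : ∀ i s a o, 0 ≤ f i s a o) (s' : S) : ∀ (n : ℕ) (s : S), 0 ≤ transport f s' n s
  | 0, s => by
    unfold transport
    split_ifs
    exacts [zero_le_one, le_rfl]
  | n + 1, s => Finset.sum_nonneg fun _ _ => mul_nonneg (transport_nonneg hf s' n _)
      (Finset.sum_nonneg fun _ _ => Finset.sum_nonneg fun _ _ => hf _ _ _ _)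

theorem transport_mul_le_transport_succ [PartialOrder B] [IsOrderedRing B]
    {f : ℕ → S → A → R × S → B} (hf : ∀ i s a o, 0 ≤ f i s a o) (s' : S) (n : ℕ) (s : S) (a : A)
    (o : R × S) : transport f s' n s * f n s a o ≤ transport f s' (n + 1) o.2 := by
  have hstep : f n s a o ≤ ∑ a, ∑ r, f n s a (r, o.2) :=
    (Finset.single_le_sum (f := fun r => f n s a (r, o.2)) (fun r _ => hf n s a _)
      (Finset.mem_univ o.1)).trans
    (Finset.single_le_sum (f := fun a => ∑ r, f n s a (r, o.2))
      (fun a _ => Finset.sum_nonneg fun r _ => hf n s a _) (Finset.mem_univ a))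
  refine (mul_le_mul_of_nonneg_left hstep (transport_nonneg hf s' n s)).trans ?_
  exact Finset.single_le_sum (f := fun s => transport f s' n s * ∑ a, ∑ r, f n s a (r, o.2))
    (fun s _ => mul_nonneg (transport_nonneg hf s' n s)
      (Finset.sum_nonneg fun a _ => Finset.sum_nonneg fun r _ => hf n s a _)) (Finset.mem_univ s)

theorem transport_apply (f : ℕ → S → A → R × S → J → B) (s' : S) (j : J) :
    ∀ (n : ℕ) (s : S), transport f s' n s j = transport (fun i s a o => f i s a o j) s' n s
  | 0, s => by
    unfold transport
    split_ifs <;> rfl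
  | n + 1, s => by
    simp only [transport, Finset.sum_apply, Pi.mul_apply, transport_apply f s' j n]

theorem transport_mul_le_of_mul_le [PartialOrder B] [IsOrderedRing B]
    {μ f : ℕ → S → A → R × S → B} {κ : ℕ → S → B} {s' : S} (hμ : ∀ i s a o, 0 ≤ μ i s a o)
    (hf : ∀ i s a o, 0 ≤ f i s a o) (h0 : κ 0 s' ≤ 1)
    (h : ∀ i s a o, μ i s a o * κ (i + 1) o.2 ≤ κ i s * f i s a o) :
    ∀ n s, transport μ s' n s * κ n s ≤ transport f s' n s := by
  intro n
  induction n with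
  | zero =>
    intro s
    unfold transport
    split_ifs with hs
    · simpa only [one_mul, hs] using h0
    · simp only [zero_mul, le_refl]
  | succ n ih =>
    intro s''
    simp only [transport, Finset.sum_mul]
    refine Finset.sum_le_sum fun s _ => ?_
    calc transport μ s' n s * (∑ a, ∑ r, μ n s a (r, s'')) * κ (n + 1) s''
        = transport μ s' n s * ∑ a, ∑ r, μ n s a (r, s'') * κ (n + 1) s'' := by
          simp only [mul_assoc, Finset.sum_mul]
      _ ≤ transport μ s' n s * ∑ a, ∑ r, κ n s * f n s a (r, s'') :=
          mul_le_mul_of_nonneg_left (Finset.sum_le_sum fun a _ => Finset.sum_le_sum fun r _ =>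
            h n s a (r, s'')) (transport_nonneg hμ s' n s)
      _ = transport μ s' n s * κ n s * ∑ a, ∑ r, f n s a (r, s'') := by
          simp only [mul_assoc, Finset.mul_sum]
      _ ≤ transport f s' n s * ∑ a, ∑ r, f n s a (r, s'') := by
          gcongr
          · exact Finset.sum_nonneg fun a _ => Finset.sum_nonneg fun r _ => hf n s a _
          · exact ih s

end Semiring

end Transport

section PosMass

variable {S A R J : Type*} [Fintype A]

/-- Action probabilities of a memoryless policy, at every time and state. -/
structure IsActionLaw (ν : ℕ → S → A → ℝ) : Prop where
  nonneg : ∀ p s a, 0 ≤ ν p s a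
  sum_eq_one : ∀ p s, ∑ a, ν p s a = 1

theorem IsActionLaw.le_one {ν : ℕ → S → A → ℝ} (hν : IsActionLaw ν) (p : ℕ) (s : S) (a : A) :
    ν p s a ≤ 1 :=
  hν.sum_eq_one p s ▸ Finset.single_le_sum (fun a _ => hν.nonneg p s a) (Finset.mem_univ a)

variable [Fintype S] [Fintype R]

/-- Probabilities of the outcomes (reward and next state) of a step, in every context. -/
structure IsStepLaw (v : ℕ → S → A → R × S → J → ℝ) : Prop where
  nonneg : ∀ p s a o, 0 ≤ v p s a o
  sum_eq_one : ∀ p s a, ∑ o, v p s a o = 1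

/-- The joint probabilities of the action and the outcome of the step at time `p` from `s`, in every
context. -/
def stepWeight (v : ℕ → S → A → R × S → J → ℝ) (ν : ℕ → S → A → ℝ) (p : ℕ) (s : S) (a : A)
    (o : R × S) : J → ℝ :=
  ν p s a • v p s a o

theorem stepWeight_nonneg {v : ℕ → S → A → R × S → J → ℝ} {ν : ℕ → S → A → ℝ}
    (hv : IsStepLaw v) (hν : IsActionLaw ν) (p : ℕ) (s : S) (a : A) (o : R × S) :
    0 ≤ stepWeight v ν p s a o :=
  smul_nonneg (hν.nonneg p s a) (hv.nonneg p s a o)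

theorem sum_mul_stepWeight {v : ℕ → S → A → R × S → J → ℝ} {ν : ℕ → S → A → ℝ}
    (hv : IsStepLaw v) (hν : IsActionLaw ν) (c : J → ℝ) (p : ℕ) (s : S) :
    ∑ a, ∑ o, c * stepWeight v ν p s a o = c := by
  simp only [stepWeight, ← Finset.mul_sum, ← Finset.smul_sum, hv.sum_eq_one, ← Finset.sum_smul,
    hν.sum_eq_one, one_smul, mul_one]

/-- The probabilities of moving from `s'` at time `p` to `s` in `n` steps, in every context. -/
noncomputable def segWeight (v : ℕ → S → A → R × S → J → ℝ) (ν : ℕ → S → A → ℝ) (p : ℕ) :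
    S → ℕ → S → J → ℝ :=
  transport fun i => stepWeight v ν (p + i)

theorem segWeight_congr {v : ℕ → S → A → R × S → J → ℝ} {ν ν' : ℕ → S → A → ℝ} (p : ℕ)
    (s' : S) (n : ℕ) (s : S) (h : ∀ i < n, ν (p + i) = ν' (p + i)) :
    segWeight v ν p s' n s = segWeight v ν' p s' n s :=
  transport_congr s' n s fun i hi => by funext s a o; simp only [stepWeight, h i hi]

variable [Fintype J]

/-- The total positive part of the signed mixture, with weights `c` of the contexts, of the laws
of `k` steps from the state `s` at time `p`. -/
def posMass (v : ℕ → S → A → R × S → J → ℝ) (ν : ℕ → S → A → ℝ) :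
    ℕ → ℕ → (J → ℝ) → S → ℝ
  | 0, _, c, _ => max (∑ j, c j) 0
  | k + 1, p, c, s => ∑ a, ∑ o : R × S, posMass v ν k (p + 1) (c * stepWeight v ν p s a o) o.2

section Sublinear

variable {v : ℕ → S → A → R × S → J → ℝ} {ν : ℕ → S → A → ℝ}

theorem posMass_nonneg : ∀ (k p : ℕ) (c : J → ℝ) (s : S), 0 ≤ posMass v ν k p c s
  | 0, _, _, _ => le_max_right _ _
  | k + 1, p, _, _ => Finset.sum_nonneg fun _ _ => Finset.sum_nonneg fun _ _ =>
      posMass_nonneg k (p + 1) _ _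

theorem posMass_add_le : ∀ (k p : ℕ) (c c' : J → ℝ) (s : S),
    posMass v ν k p (c + c') s ≤ posMass v ν k p c s + posMass v ν k p c' s
  | 0, _, c, c', _ => by
    simp only [posMass, Pi.add_apply, Finset.sum_add_distrib]
    exact max_le (add_le_add (le_max_left _ _) (le_max_left _ _))
      (add_nonneg (le_max_right _ _) (le_max_right _ _))
  | k + 1, p, c, c', s => by
    simp only [posMass, ← Finset.sum_add_distrib, add_mul]
    exact Finset.sum_le_sum fun a _ => Finset.sum_le_sum fun o _ => posMass_add_le k (p + 1) _ _ _

theorem posMass_smul {x : ℝ} (hx : 0 ≤ x) : ∀ (k p : ℕ) (c : J → ℝ) (s : S),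
    posMass v ν k p (x • c) s = x * posMass v ν k p c s
  | 0, _, c, _ => by
    simp only [posMass, Pi.smul_apply, smul_eq_mul, ← Finset.mul_sum, mul_max_of_nonneg _ _ hx,
      mul_zero]
  | k + 1, p, c, s => by
    simp only [posMass, Finset.mul_sum, smul_mul_assoc, posMass_smul hx k (p + 1)]

theorem posMass_zero (k p : ℕ) (s : S) : posMass v ν k p 0 s = 0 := by
  simpa only [zero_smul, zero_mul] using posMass_smul (v := v) (ν := ν) le_rfl k p 0 s

theorem posMass_sum_le {ι : Type*} (t : Finset ι) (k p : ℕ) (c : ι → J → ℝ) (s : S) :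
    posMass v ν k p (∑ i ∈ t, c i) s ≤ ∑ i ∈ t, posMass v ν k p (c i) s :=
  Finset.le_sum_of_subadditive (posMass v ν k p · s) (posMass_zero k p s).le
    (fun c c' => posMass_add_le k p c c' s) t c

theorem posMass_congr {ν' : ℕ → S → A → ℝ} : ∀ (k p : ℕ) (c : J → ℝ) (s : S),
    (∀ q, p ≤ q → ν q = ν' q) → posMass v ν k p c s = posMass v ν' k p c s
  | 0, _, _, _, _ => rfl
  | k + 1, p, c, s, h => by
    simp only [posMass, stepWeight, h p le_rfl]
    exact Finset.sum_congr rfl fun a _ => Finset.sum_congr rfl fun o _ =>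
      posMass_congr k (p + 1) _ _ fun q hq => h q (by omega)

/-- Merging the paths of a segment lets positive and negative parts cancel. -/
theorem sum_posMass_mul_segWeight_le (p : ℕ) (c : J → ℝ) (s' : S) (n k : ℕ) :
    ∑ s, posMass v ν k (p + n) (c * segWeight v ν p s' n s) s ≤ posMass v ν (n + k) p c s' := by
  induction n generalizing k with
  | zero =>
    rw [Finset.sum_eq_single s']
    · simp [segWeight, transport]
    · intro s _ hs
      simp [segWeight, transport, hs, posMass_zero]
    · simp
  | succ n ih =>
    have hsplit (s'' : S) : posMass v ν k (p + n + 1) (c * segWeight v ν p s' (n + 1) s'') s'' ≤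
        ∑ s, ∑ a, ∑ r, posMass v ν k (p + n + 1)
          (c * segWeight v ν p s' n s * stepWeight v ν (p + n) s a (r, s'')) s'' := by
      have hexpand : c * segWeight v ν p s' (n + 1) s'' =
          ∑ s, ∑ a, ∑ r, c * segWeight v ν p s' n s * stepWeight v ν (p + n) s a (r, s'') := by
        simp only [segWeight, transport, Finset.mul_sum, mul_assoc]
      rw [hexpand]
      refine (posMass_sum_le _ _ _ _ _).trans (Finset.sum_le_sum fun s _ => ?_)
      refine (posMass_sum_le _ _ _ _ _).trans (Finset.sum_le_sum fun a _ => ?_)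
      exact posMass_sum_le _ _ _ _ _
    rw [Nat.add_right_comm]
    refine (Finset.sum_le_sum fun s'' _ => hsplit s'').trans (le_trans (le_of_eq ?_) (ih (k + 1)))
    simp only [posMass, Fintype.sum_prod_type]
    rw [Finset.sum_comm]
    refine Finset.sum_congr rfl fun s _ => ?_
    rw [Finset.sum_comm]
    exact Finset.sum_congr rfl fun a _ => Finset.sum_comm

end Sublinear

section Laws

variable {v : ℕ → S → A → R × S → J → ℝ} {ν : ℕ → S → A → ℝ}

theorem posMass_of_nonpos (hv : IsStepLaw v) (hν : IsActionLaw ν) :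
    ∀ (k p : ℕ) {c : J → ℝ} (s : S), c ≤ 0 → posMass v ν k p c s = 0
  | 0, _, _, _, h => max_eq_right (Finset.sum_nonpos fun j _ => h j)
  | k + 1, p, _, s, h => Finset.sum_eq_zero fun a _ => Finset.sum_eq_zero fun o _ =>
      posMass_of_nonpos hv hν k (p + 1) o.2
        (mul_nonpos_of_nonpos_of_nonneg h (stepWeight_nonneg hv hν p s a o))

theorem posMass_of_nonneg (hv : IsStepLaw v) (hν : IsActionLaw ν) :
    ∀ (k p : ℕ) {c : J → ℝ} (s : S), 0 ≤ c → posMass v ν k p c s = ∑ j, c j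
  | 0, _, _, _, h => max_eq_left (Finset.sum_nonneg fun j _ => h j)
  | k + 1, p, c, s, h => by
    calc posMass v ν (k + 1) p c s
        = ∑ a, ∑ o, ∑ j, (c * stepWeight v ν p s a o) j :=
          Finset.sum_congr rfl fun a _ => Finset.sum_congr rfl fun o _ =>
            posMass_of_nonneg hv hν k (p + 1) o.2 (mul_nonneg h (stepWeight_nonneg hv hν p s a o))
      _ = ∑ j, (∑ a, ∑ o, c * stepWeight v ν p s a o) j := by
          simp only [Finset.sum_apply]
          conv_rhs => rw [Finset.sum_comm]
          exact Finset.sum_congr rfl fun a _ => Finset.sum_comm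
      _ = ∑ j, c j := by rw [sum_mul_stepWeight hv hν]

theorem posMass_eq_of_subsingleton_support {ν' : ℕ → S → A → ℝ} (hv : IsStepLaw v)
    (hν : IsActionLaw ν) (hν' : IsActionLaw ν') (k p : ℕ) {c : J → ℝ} (s : S)
    (hc : (Function.support c).Subsingleton) : posMass v ν k p c s = posMass v ν' k p c s := by
  have hsign : 0 ≤ c ∨ c ≤ 0 := by
    by_contra! h
    simp only [Pi.le_def, Pi.zero_apply, not_forall, not_le] at h
    obtain ⟨⟨i, hi⟩, j, hj⟩ := h
    obtain rfl : i = j := hc hi.ne hj.ne'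
    exact lt_asymm hi hj
  rcases hsign with h | h
  · rw [posMass_of_nonneg hv hν k p s h, posMass_of_nonneg hv hν' k p s h]
  · rw [posMass_of_nonpos hv hν k p s h, posMass_of_nonpos hv hν' k p s h]

theorem posMass_succ_le (hν : IsActionLaw ν) (k p : ℕ) (c : J → ℝ) (s : S) :
    posMass v ν (k + 1) p c s ≤ ∑ a, ∑ o : R × S, posMass v ν k (p + 1) (c * v p s a o) o.2 := by
  refine Finset.sum_le_sum fun a _ => Finset.sum_le_sum fun o _ => ?_
  rw [stepWeight, mul_smul_comm, posMass_smul (hν.nonneg p s a)]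
  exact mul_le_of_le_one_left (posMass_nonneg _ _ _ _) (hν.le_one p s a)

end Laws

end PosMass

/-! ### Gauges -/

section Gauge

variable {S A R J : Type*}

theorem exists_max_scale {T : Set J} (hT : T.Finite) {a b : J → ℝ} (ha : ∀ j ∈ T, 0 ≤ a j)
    (hb : 0 ≤ b) : ∃ x : ℝ, 0 ≤ x ∧ (∀ j ∈ T, x * b j ≤ a j) ∧
      ((∃ j ∈ T, b j ≠ 0) → ∃ j ∈ T, x * b j = a j) ∧ ((∀ j ∈ T, b j = 0) → x = 0) := by
  by_cases h : ∃ j ∈ T, b j ≠ 0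
  · obtain ⟨j₀, hj₀⟩ := h
    obtain ⟨j, ⟨hjT, hj⟩, hmin⟩ := Set.exists_min_image {j | j ∈ T ∧ b j ≠ 0} (fun j => a j / b j)
      (hT.subset fun j hj => hj.1) ⟨j₀, hj₀⟩
    refine ⟨a j / b j, div_nonneg (ha j hjT) (hb j), fun i hi => ?_,
      fun _ => ⟨j, hjT, div_mul_cancel₀ _ hj⟩, fun h0 => absurd (h0 j hjT) hj⟩
    by_cases hbi : b i = 0
    · simpa only [hbi, mul_zero] using ha i hi
    · exact (le_div_iff₀ ((hb i).lt_of_ne' hbi)).1 (hmin i ⟨hi, hbi⟩)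
  · push Not at h
    exact ⟨0, le_rfl, fun j hj => by simpa only [zero_mul] using ha j hj,
      fun ⟨j, hj, hbj⟩ => absurd (h j hj) hbj, fun _ => rfl⟩

/-- A gauge `κ` for the step weights `f` on the contexts of `T`: the amounts `κ i s` are passed on
by the scalar weights `μ`, which are the largest ones such that every context of `T` can afford
them. -/
structure IsGauge (f : ℕ → S → A → R × S → J → ℝ) (s' : S) (T : Set J) (κ : ℕ → S → J → ℝ)
    (μ : ℕ → S → A → R × S → ℝ) : Prop where
  nonneg : ∀ i s, 0 ≤ κ i s
  init : κ 0 s' = 1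
  scale_nonneg : ∀ i s a o, 0 ≤ μ i s a o
  scale_mul_le : ∀ i s a o, ∀ j ∈ T, μ i s a o * κ (i + 1) o.2 j ≤ κ i s j * f i s a o j
  scale_tight : ∀ i s a o, (∃ j ∈ T, κ (i + 1) o.2 j ≠ 0) →
    ∃ j ∈ T, μ i s a o * κ (i + 1) o.2 j = κ i s j * f i s a o j
  scale_eq_zero : ∀ i s a o, (∀ j ∈ T, κ (i + 1) o.2 j = 0) → μ i s a o = 0

theorem exists_isGauge {f : ℕ → S → A → R × S → J → ℝ} (hf : ∀ i s a o, 0 ≤ f i s a o) {s' : S}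
    {T : Set J} (hT : T.Finite) {κ : ℕ → S → J → ℝ} (hκ : ∀ i s, 0 ≤ κ i s) (hκ₀ : κ 0 s' = 1) :
    ∃ μ, IsGauge f s' T κ μ := by
  have hscale (i s a) (o : R × S) := exists_max_scale hT
    (fun j _ => mul_nonneg (hκ i s j) (hf i s a o j)) (hκ (i + 1) o.2)
  choose μ hμ using hscale
  exact ⟨μ, hκ, hκ₀, fun i s a o => (hμ i s a o).1, fun i s a o => (hμ i s a o).2.1,
    fun i s a o => (hμ i s a o).2.2.1, fun i s a o => (hμ i s a o).2.2.2⟩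

/-- What is left of the weights `κ i s * f i s a o` after passing on the gauge. -/
def gaugeResidual (f : ℕ → S → A → R × S → J → ℝ) (κ : ℕ → S → J → ℝ) (μ : ℕ → S → A → R × S → ℝ)
    (i : ℕ) (s : S) (a : A) (o : R × S) : J → ℝ :=
  κ i s * f i s a o - μ i s a o • κ (i + 1) o.2

namespace IsGauge

variable {f : ℕ → S → A → R × S → J → ℝ} {s' : S} {T : Set J} {κ : ℕ → S → J → ℝ}
  {μ : ℕ → S → A → R × S → ℝ}

theorem residual_nonneg (h : IsGauge f s' T κ μ) (i : ℕ) (s : S) (a : A) (o : R × S) {j : J}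
    (hj : j ∈ T) : 0 ≤ gaugeResidual f κ μ i s a o j :=
  sub_nonneg.2 (h.scale_mul_le i s a o j hj)

theorem exists_residual_eq_zero (h : IsGauge f s' T κ μ) (i : ℕ) (s : S) (a : A) {o : R × S}
    (ho : ∃ j ∈ T, κ (i + 1) o.2 j ≠ 0) : ∃ j ∈ T, gaugeResidual f κ μ i s a o j = 0 :=
  let ⟨j, hj, heq⟩ := h.scale_tight i s a o ho
  ⟨j, hj, sub_eq_zero.2 heq.symm⟩

variable [Fintype S] [Fintype A] [Fintype R]

theorem transport_mul_le (h : IsGauge f s' T κ μ) (hf : ∀ i s a o, 0 ≤ f i s a o) (i : ℕ) (s : S)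
    {j : J} (hj : j ∈ T) : transport μ s' i s * κ i s j ≤ transport f s' i s j := by
  rw [transport_apply]
  exact transport_mul_le_of_mul_le (κ := fun i s => κ i s j) h.scale_nonneg
    (fun i s a o => hf i s a o j) (congr_fun h.init j).le
    (fun i s a o => h.scale_mul_le i s a o j hj) i s

theorem exists_ne_zero_of_transport_ne_zero (h : IsGauge f s' T κ μ) (hT : T.Nonempty) :
    ∀ {i : ℕ} {s : S}, transport μ s' i s ≠ 0 → ∃ j ∈ T, κ i s j ≠ 0
  | 0, s, hs => by
    obtain rfl : s = s' := by
      by_contra hne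
      simp only [transport, hne, if_false, ne_eq, not_true_eq_false] at hs
    obtain ⟨j, hj⟩ := hT
    exact ⟨j, hj, by simp only [h.init, Pi.one_apply, ne_eq, one_ne_zero, not_false_eq_true]⟩
  | i + 1, s, hs => by
    by_contra! hκ
    refine hs (Finset.sum_eq_zero fun s₀ _ => mul_eq_zero_of_right _ ?_)
    exact Finset.sum_eq_zero fun a _ => Finset.sum_eq_zero fun r _ =>
      h.scale_eq_zero i s₀ a (r, s) hκ

theorem transport_pos_of_residual_ne_zero (h : IsGauge f s' T κ μ) (hf : ∀ i s a o, 0 ≤ f i s a o)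
    {i : ℕ} {s : S} {a : A} {o : R × S} (hs : transport μ s' i s ≠ 0) {j : J} (hj : j ∈ T)
    (hr : gaugeResidual f κ μ i s a o j ≠ 0) : 0 < transport f s' (i + 1) o.2 j := by
  have hstep : 0 < κ i s j * f i s a o j :=
    ((h.residual_nonneg i s a o hj).lt_of_ne' hr).trans_le
      (sub_le_self _ (mul_nonneg (h.scale_nonneg i s a o) (h.nonneg _ _ j)))
  have hκ : 0 < κ i s j := (h.nonneg i s j).lt_of_ne' (left_ne_zero_of_mul hstep.ne')
  have hμ : 0 < transport μ s' i s := (transport_nonneg h.scale_nonneg s' i s).lt_of_ne' hs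
  calc 0 < transport f s' i s j * f i s a o j :=
        mul_pos ((mul_pos hμ hκ).trans_le (h.transport_mul_le hf i s hj))
          ((hf i s a o j).lt_of_ne' (right_ne_zero_of_mul hstep.ne'))
    _ ≤ transport f s' (i + 1) o.2 j := transport_mul_le_transport_succ hf s' i s a o j

end IsGauge

variable [Fintype S] [Fintype A] [Fintype R] [Fintype J] {v : ℕ → S → A → R × S → J → ℝ}
  {ν : ℕ → S → A → ℝ}

theorem posMass_mul_le_residual_add {μ : ℕ → S → A → R × S → ℝ} (hμ : ∀ i s a o, 0 ≤ μ i s a o)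
    (κ : ℕ → S → J → ℝ) (k p i : ℕ) (c : J → ℝ) (s : S) :
    posMass v ν (k + 1) (p + i) (c * κ i s) s ≤
      (∑ a, ∑ o : R × S, posMass v ν k (p + i + 1)
        (c * gaugeResidual (fun i => stepWeight v ν (p + i)) κ μ i s a o) o.2) +
      ∑ a, ∑ o : R × S, μ i s a o * posMass v ν k (p + i + 1) (c * κ (i + 1) o.2) o.2 := by
  simp only [posMass, ← Finset.sum_add_distrib]
  refine Finset.sum_le_sum fun a _ => Finset.sum_le_sum fun o _ => ?_
  have hsplit : c * κ i s * stepWeight v ν (p + i) s a o =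
      c * gaugeResidual (fun i => stepWeight v ν (p + i)) κ μ i s a o
        + μ i s a o • (c * κ (i + 1) o.2) := by
    rw [gaugeResidual, mul_sub, mul_smul_comm, sub_add_cancel, mul_assoc]
  rw [hsplit, ← posMass_smul (hμ i s a o)]
  exact posMass_add_le _ _ _ _ _

theorem posMass_le_sum_residual {μ : ℕ → S → A → R × S → ℝ} (hμ : ∀ i s a o, 0 ≤ μ i s a o)
    {κ : ℕ → S → J → ℝ} {s' : S} (hκ : κ 0 s' = 1) (k p : ℕ) (c : J → ℝ) {n : ℕ} (hn : n ≤ k) :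
    posMass v ν (k + 1) p c s' ≤
      (∑ i ∈ Finset.range n, ∑ s, transport μ s' i s * ∑ a, ∑ o : R × S,
        posMass v ν (k - i) (p + i + 1)
          (c * gaugeResidual (fun i => stepWeight v ν (p + i)) κ μ i s a o) o.2) +
      ∑ s, transport μ s' n s * posMass v ν (k + 1 - n) (p + n) (c * κ n s) s := by
  induction n with
  | zero =>
    rw [sum_transport_zero_mul, hκ, mul_one, Finset.sum_range_zero, zero_add]
    rfl
  | succ n ih =>
    refine (ih (by omega)).trans ?_
    rw [Finset.sum_range_succ, add_assoc]
    gcongr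
    rw [show k + 1 - n = k - n + 1 by omega, show k + 1 - (n + 1) = k - n by omega,
      ← sum_transport_mul_sum, ← Finset.sum_add_distrib]
    refine Finset.sum_le_sum fun s _ => ?_
    rw [← mul_add]
    exact mul_le_mul_of_nonneg_left (posMass_mul_le_residual_add hμ κ (k - n) p n c s)
      (transport_nonneg hμ s' n s)

theorem sum_transport_mul_posMass_residual_le {μ : ℕ → S → A → R × S → ℝ} {π : ℕ → S → A → ℝ}
    (hμ : ∀ i s a o, 0 ≤ μ i s a o) (hπ : IsActionLaw π) (κ : ℕ → S → J → ℝ) (s' : S)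
    (k p q i : ℕ) (c : J → ℝ) :
    ∑ s, transport μ s' i s * ∑ a, ∑ o : R × S,
      posMass v ν k q (c * gaugeResidual (fun i => stepWeight v π (p + i)) κ μ i s a o) o.2 ≤
    (∑ s, transport μ s' i s * ∑ a, ∑ o : R × S,
      posMass v ν k q (c * (κ i s * v (p + i) s a o)) o.2) +
    ∑ s, transport μ s' (i + 1) s * posMass v ν k q (-c * κ (i + 1) s) s := by
  rw [← sum_transport_mul_sum, ← Finset.sum_add_distrib]
  refine Finset.sum_le_sum fun s _ => ?_
  rw [← mul_add]
  refine mul_le_mul_of_nonneg_left ?_ (transport_nonneg hμ s' i s)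
  simp only [← Finset.sum_add_distrib]
  refine Finset.sum_le_sum fun a _ => Finset.sum_le_sum fun o _ => ?_
  have hsplit : c * gaugeResidual (fun i => stepWeight v π (p + i)) κ μ i s a o =
      π (p + i) s a • (c * (κ i s * v (p + i) s a o)) + μ i s a o • (-c * κ (i + 1) o.2) := by
    rw [gaugeResidual, stepWeight, mul_sub, mul_smul_comm, mul_smul_comm, mul_smul_comm, neg_mul,
      smul_neg, sub_eq_add_neg]
  rw [hsplit]
  refine (posMass_add_le _ _ _ _ _).trans (add_le_add ?_ (posMass_smul (hμ i s a o) _ _ _ _).le)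
  rw [posMass_smul (hπ.nonneg _ _ _)]
  exact mul_le_of_le_one_left (posMass_nonneg _ _ _ _) (hπ.le_one _ _ _)

end Gauge

/-! ### Schedules of checkpoints -/

section Schedule

variable {S A Q : Type*}

/-- A time step of a schedule, together with the policy executed up to it; `random` tells whether
the action at this time step itself is random. -/
structure Checkpoint (Q : Type*) where
  time : ℕ
  random : Bool
  policy : Q

/-- The policy following a list of checkpoints. It follows `u` at the random checkpoints and after
the last one. -/
def schedulePolicy (act : Q → ℕ → S → A → ℝ) (u : ℕ → S → A → ℝ) :
    List (Checkpoint Q) → ℕ → S → A → ℝ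
  | [], t => u t
  | e :: l, t =>
    if t < e.time then act e.policy t
    else if t = e.time then (if e.random = true then u t else act e.policy t)
    else schedulePolicy act u l t

theorem isActionLaw_schedulePolicy [Fintype A] {act : Q → ℕ → S → A → ℝ} {u : ℕ → S → A → ℝ}
    (hact : ∀ ψ, IsActionLaw (act ψ)) (hu : IsActionLaw u) :
    ∀ l, IsActionLaw (schedulePolicy act u l)
  | [] => ⟨hu.nonneg, hu.sum_eq_one⟩
  | e :: l => by
    have ih := isActionLaw_schedulePolicy hact hu l
    constructor <;> intro t s <;> simp only [schedulePolicy] <;> split_ifs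
    exacts [(hact _).nonneg t s, hu.nonneg t s, (hact _).nonneg t s, ih.nonneg t s,
      (hact _).sum_eq_one t s, hu.sum_eq_one t s, (hact _).sum_eq_one t s, ih.sum_eq_one t s]

theorem schedulePolicy_cons_of_lt (act : Q → ℕ → S → A → ℝ) (u : ℕ → S → A → ℝ)
    {e : Checkpoint Q} (l : List (Checkpoint Q)) {t : ℕ} (ht : t < e.time) :
    schedulePolicy act u (e :: l) t = act e.policy t :=
  if_pos ht

theorem schedulePolicy_cons_time (act : Q → ℕ → S → A → ℝ) (u : ℕ → S → A → ℝ) (e : Checkpoint Q)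
    (l : List (Checkpoint Q)) :
    schedulePolicy act u (e :: l) e.time =
      if e.random = true then u e.time else act e.policy e.time := by
  simp only [schedulePolicy, lt_irrefl, if_true, if_false]

theorem schedulePolicy_cons_of_gt (act : Q → ℕ → S → A → ℝ) (u : ℕ → S → A → ℝ)
    {e : Checkpoint Q} (l : List (Checkpoint Q)) {t : ℕ} (ht : e.time < t) :
    schedulePolicy act u (e :: l) t = schedulePolicy act u l t := by
  simp only [schedulePolicy, ht.not_gt, ht.ne', if_false]

open Classical in
/-- The first checkpoints of the schedules in `schedules`. -/
noncomputable def firstCheckpoints (Cand : ℕ → ℕ → Finset Q) (k p : ℕ) : Finset (Checkpoint Q) :=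
  ((Finset.range (k + 1)).sigma fun i => Cand p (p + i)).image (fun x => ⟨p + x.1, true, x.2⟩) ∪
    ((Finset.range k).sigma fun i => Cand p (p + i + 1)).image (fun x => ⟨p + x.1, false, x.2⟩)

open Classical in
/-- The lists of at most `n` increasing checkpoints in the `k` time steps from `p` on. The segment
ending at a random checkpoint runs up to the state before its action, any other one up to the state
after it, and its policy is a candidate in `Cand` for the first and last time of the segment. -/
noncomputable def schedules (Cand : ℕ → ℕ → Finset Q) : ℕ → ℕ → ℕ → Finset (List (Checkpoint Q))
  | 0, _, _ => {[]}
  | _ + 1, 0, _ => {[]}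
  | n + 1, k + 1, p => (firstCheckpoints Cand k p).biUnion fun e =>
      (schedules Cand n (p + k - e.time) (e.time + 1)).image (List.cons e)

theorem schedules_zero_right (Cand : ℕ → ℕ → Finset Q) (n p : ℕ) :
    schedules Cand n 0 p = {[]} := by
  cases n <;> rfl

theorem sum_firstCheckpoints {B : Type*} [AddCommMonoid B] (Cand : ℕ → ℕ → Finset Q) (k p : ℕ)
    (F : Checkpoint Q → B) :
    ∑ e ∈ firstCheckpoints Cand k p, F e =
      (∑ i ∈ Finset.range (k + 1), ∑ ψ ∈ Cand p (p + i), F ⟨p + i, true, ψ⟩) +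
      ∑ i ∈ Finset.range k, ∑ ψ ∈ Cand p (p + i + 1), F ⟨p + i, false, ψ⟩ := by
  classical
  have hinj (b : Bool) :
      Function.Injective fun x : (_ : ℕ) × Q => (⟨p + x.1, b, x.2⟩ : Checkpoint Q) := by
    rintro ⟨i, ψ⟩ ⟨i', ψ'⟩ h
    simpa only [Checkpoint.mk.injEq, add_right_inj, true_and, Sigma.mk.injEq, heq_eq_eq] using h
  rw [firstCheckpoints, Finset.sum_union, Finset.sum_image (hinj true).injOn,
    Finset.sum_image (hinj false).injOn, Finset.sum_sigma, Finset.sum_sigma]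
  simp only [Finset.disjoint_left, Finset.mem_image]
  rintro _ ⟨x, _, rfl⟩ ⟨y, _, h⟩
  simp only [Checkpoint.mk.injEq, Bool.false_eq_true, false_and, and_false] at h

theorem sum_schedules_succ {B : Type*} [AddCommMonoid B] (Cand : ℕ → ℕ → Finset Q) (n k p : ℕ)
    (F : List (Checkpoint Q) → B) :
    ∑ l ∈ schedules Cand (n + 1) (k + 1) p, F l =
      (∑ i ∈ Finset.range (k + 1), ∑ ψ ∈ Cand p (p + i),
        ∑ l ∈ schedules Cand n (k - i) (p + i + 1), F (⟨p + i, true, ψ⟩ :: l)) +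
      ∑ i ∈ Finset.range k, ∑ ψ ∈ Cand p (p + i + 1),
        ∑ l ∈ schedules Cand n (k - i) (p + i + 1), F (⟨p + i, false, ψ⟩ :: l) := by
  classical
  rw [schedules, Finset.sum_biUnion]
  · simp only [Finset.sum_image (List.cons_injective.injOn), sum_firstCheckpoints,
      Nat.add_sub_add_left]
  · intro e _ e' _ hne
    simp only [Function.onFun, Finset.disjoint_left, Finset.mem_image]
    rintro _ ⟨l, _, rfl⟩ ⟨l', _, h⟩
    exact hne (List.cons.inj h).1.symm

theorem sum_schedules_prod_le (Cand : ℕ → ℕ → Finset Q) {g : Bool → Q → ℝ}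
    (hg : ∀ b ψ, 0 ≤ g b ψ) {B : ℝ}
    (hB : ∀ p q q', ∑ ψ ∈ Cand p q, g true ψ + ∑ ψ ∈ Cand p q', g false ψ ≤ B) {H : ℕ}
    (hBH : 1 ≤ H * B) : ∀ n k p, k ≤ H →
    ∑ l ∈ schedules Cand n k p, (l.map fun e => g e.random e.policy).prod ≤ (H * B) ^ n := by
  intro n
  induction n with
  | zero =>
    intro k p _
    simp only [schedules, Finset.sum_singleton, List.map_nil, List.prod_nil, pow_zero, le_refl]
  | succ n ih =>
    intro k p hk
    obtain _ | k := k
    · simp only [schedules, Finset.sum_singleton, List.map_nil, List.prod_nil]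
      exact one_le_pow₀ hBH
    have hpow : 0 ≤ (H * B) ^ n := pow_nonneg (zero_le_one.trans hBH) n
    have hB₀ : 0 ≤ B := (add_nonneg (Finset.sum_nonneg fun ψ _ => hg true ψ)
      (Finset.sum_nonneg fun ψ _ => hg false ψ)).trans (hB 0 0 0)
    have hcons (i q : ℕ) (b : Bool) : ∑ ψ ∈ Cand p q, g b ψ *
        ∑ l ∈ schedules Cand n (k - i) (p + i + 1), (l.map fun e => g e.random e.policy).prod
        ≤ (∑ ψ ∈ Cand p q, g b ψ) * (H * B) ^ n := by
      rw [Finset.sum_mul]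
      exact Finset.sum_le_sum fun ψ _ =>
        mul_le_mul_of_nonneg_left (ih _ _ (by omega)) (hg b ψ)
    simp only [sum_schedules_succ, List.map_cons, List.prod_cons, ← Finset.mul_sum]
    calc _ ≤ (∑ i ∈ Finset.range (k + 1), (∑ ψ ∈ Cand p (p + i), g true ψ) * (H * B) ^ n) +
          ∑ i ∈ Finset.range (k + 1), (∑ ψ ∈ Cand p (p + i + 1), g false ψ) * (H * B) ^ n := by
          refine add_le_add (Finset.sum_le_sum fun i _ => hcons i _ true)
            ((Finset.sum_le_sum fun i _ => hcons i _ false).trans ?_)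
          refine Finset.sum_le_sum_of_subset_of_nonneg
            (Finset.range_subset_range.2 k.le_succ) fun i _ _ => ?_
          exact mul_nonneg (Finset.sum_nonneg fun ψ _ => hg false ψ) hpow
      _ ≤ ∑ _i ∈ Finset.range (k + 1), B * (H * B) ^ n := by
          rw [← Finset.sum_add_distrib]
          refine Finset.sum_le_sum fun i _ => ?_
          rw [← add_mul]
          exact mul_le_mul_of_nonneg_right (hB _ _ _) hpow
      _ = (k + 1 : ℕ) * B * (H * B) ^ n := by
          rw [Finset.sum_const, Finset.card_range, nsmul_eq_mul, mul_assoc]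
      _ ≤ (H * B) ^ (n + 1) := by
          rw [pow_succ']
          gcongr

/-- The importance weight of a schedule: a factor `C` for the gauge of every segment, and `K` for
every random action. -/
noncomputable def scheduleWeight (C K : ℝ) (l : List (Checkpoint Q)) : ℝ :=
  (l.map fun e => C * if e.random = true then K else 1).prod

/-- The sign of a schedule, `-1` for every checkpoint which is not random. -/
def scheduleSign (l : List (Checkpoint Q)) : ℝ :=
  (l.map fun e => if e.random = true then (1 : ℝ) else -1).prod

theorem scheduleWeight_nonneg {C K : ℝ} (hC : 0 ≤ C) (hK : 0 ≤ K) (l : List (Checkpoint Q)) :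
    0 ≤ scheduleWeight C K l := by
  refine List.prod_nonneg fun x hx => ?_
  obtain ⟨e, _, rfl⟩ := List.mem_map.1 hx
  split_ifs <;> positivity

theorem scheduleWeight_cons (C K : ℝ) (e : Checkpoint Q) (l : List (Checkpoint Q)) :
    scheduleWeight C K (e :: l) =
      (C * if e.random = true then K else 1) * scheduleWeight C K l := by
  simp only [scheduleWeight, List.map_cons, List.prod_cons]

theorem scheduleSign_cons (e : Checkpoint Q) (l : List (Checkpoint Q)) :
    scheduleSign (e :: l) = (if e.random = true then (1 : ℝ) else -1) * scheduleSign l := by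
  simp only [scheduleSign, List.map_cons, List.prod_cons]

theorem scheduleSign_eq_one_or_neg_one (l : List (Checkpoint Q)) :
    scheduleSign l = 1 ∨ scheduleSign l = -1 := by
  induction l with
  | nil => exact Or.inl rfl
  | cons e l ih =>
    rw [scheduleSign_cons]
    rcases ih with h | h <;> rw [h] <;> split_ifs <;> simp

end Schedule

section CheckpointMass

variable {S A R J Q : Type*} [Fintype S] [Fintype A] [Fintype R] [Fintype J]
  {v : ℕ → S → A → R × S → J → ℝ} {act : Q → ℕ → S → A → ℝ} {u : ℕ → S → A → ℝ}

theorem sum_posMass_random_checkpoint_le {K : ℝ} (hK : 0 < K) (hu : ∀ p s a, u p s a = K⁻¹)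
    {i k : ℕ} (hi : i ≤ k) (p : ℕ) (ψ : Q) (l : List (Checkpoint Q)) (c : J → ℝ) (s' : S) :
    ∑ s, ∑ a, ∑ o : R × S, posMass v (schedulePolicy act u l) (k - i) (p + i + 1)
        (c * (segWeight v (act ψ) p s' i s * v (p + i) s a o)) o.2
      ≤ K * posMass v (schedulePolicy act u (⟨p + i, true, ψ⟩ :: l)) (k + 1) p c s' := by
  set ν := schedulePolicy act u (⟨p + i, true, ψ⟩ :: l) with hν
  have hrandom (s : S) (a : A) : ν (p + i) s a = K⁻¹ := by
    rw [hν, schedulePolicy_cons_time]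
    exact hu _ s a
  calc _ = K * ∑ s, posMass v ν (k - i + 1) (p + i) (c * segWeight v ν p s' i s) s := by
        simp only [posMass, Finset.mul_sum]
        refine Finset.sum_congr rfl fun s _ => Finset.sum_congr rfl fun a _ =>
          Finset.sum_congr rfl fun o _ => ?_
        rw [stepWeight, hrandom, mul_smul_comm, posMass_smul (inv_nonneg.2 hK.le),
          mul_inv_cancel_left₀ hK.ne', mul_assoc,
          segWeight_congr p s' i s fun n hn => schedulePolicy_cons_of_lt act u l
            (show p + n < p + i by omega)]
        exact posMass_congr _ _ _ _ fun q hq => (schedulePolicy_cons_of_gt act u l hq).symm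
    _ ≤ K * posMass v ν (i + (k - i + 1)) p c s' :=
        mul_le_mul_of_nonneg_left (sum_posMass_mul_segWeight_le p c s' i _) hK.le
    _ = K * posMass v ν (k + 1) p c s' := by rw [show i + (k - i + 1) = k + 1 by omega]

theorem sum_posMass_checkpoint_le {i k : ℕ} (hi : i ≤ k) (p : ℕ) (ψ : Q)
    (l : List (Checkpoint Q)) (c : J → ℝ) (s' : S) :
    ∑ s, posMass v (schedulePolicy act u l) (k - i) (p + i + 1)
        (c * segWeight v (act ψ) p s' (i + 1) s) s
      ≤ posMass v (schedulePolicy act u (⟨p + i, false, ψ⟩ :: l)) (k + 1) p c s' := by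
  set ν := schedulePolicy act u (⟨p + i, false, ψ⟩ :: l) with hν
  have hfollow (n : ℕ) (hn : n < i + 1) : ν (p + n) = act ψ (p + n) := by
    rcases (Nat.lt_succ_iff.1 hn).lt_or_eq with h | rfl
    · exact schedulePolicy_cons_of_lt act u l (show p + n < p + i by omega)
    · exact schedulePolicy_cons_time act u _ l
  calc _ = ∑ s, posMass v ν (k - i) (p + (i + 1)) (c * segWeight v ν p s' (i + 1) s) s :=
        Finset.sum_congr rfl fun s _ => by
          rw [segWeight_congr p s' (i + 1) s hfollow]
          exact posMass_congr _ _ _ _ fun q hq => (schedulePolicy_cons_of_gt act u l hq).symm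
    _ ≤ posMass v ν (i + 1 + (k - i)) p c s' := sum_posMass_mul_segWeight_le p c s' (i + 1) _
    _ = posMass v ν (k + 1) p c s' := by rw [show i + 1 + (k - i) = k + 1 by omega]

end CheckpointMass

section OffPolicy

variable {S A R J Q : Type*} [Fintype S] [Fintype A] [Fintype R]

/-- The candidates `Cand p q` cover, up to a factor `C`, the segments from time `p` to time `q < H`
which `π` enters. The predicate `Vis p j s` tells that `π` may visit `s` at time `p` in context
`j`. -/
structure IsCover (v : ℕ → S → A → R × S → J → ℝ) (π : ℕ → S → A → ℝ) (act : Q → ℕ → S → A → ℝ)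
    (Vis : ℕ → J → S → Prop) (Cand : ℕ → ℕ → Finset Q) (C : ℝ) (H : ℕ) : Prop where
  vis : ∀ {p n j s' s}, p + n < H → Vis p j s' → 0 < segWeight v π p s' n s j → Vis (p + n) j s
  exists_le : ∀ {p n j s'} s, p + n < H → Vis p j s' →
    ∃ ψ ∈ Cand p (p + n), segWeight v π p s' n s j ≤ C * segWeight v (act ψ) p s' n s j

/-- A gauge for the steps of `π` from time `p` on, in the contexts of nonzero weight `c`, which
consists of segment probabilities of candidate policies. -/
structure IsCoveringGauge (v : ℕ → S → A → R × S → J → ℝ) (π : ℕ → S → A → ℝ)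
    (act : Q → ℕ → S → A → ℝ) (Cand : ℕ → ℕ → Finset Q) (C : ℝ) (k p : ℕ) (c : J → ℝ) (s' : S)
    (κ : ℕ → S → J → ℝ) (μ : ℕ → S → A → R × S → ℝ) : Prop
    extends IsGauge (fun i => stepWeight v π (p + i)) s' (Function.support c) κ μ where
  live : ∀ i ≤ k, ∀ s j, 0 < c j → 0 < segWeight v π p s' i s j →
    ∃ j ∈ Function.support c, κ i s j ≠ 0
  candidate : ∀ i ≤ k, ∀ s, transport μ s' i s ≠ 0 →
    transport μ s' i s ≤ C ∧ ∃ ψ ∈ Cand p (p + i), κ i s = segWeight v (act ψ) p s' i s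

variable {v : ℕ → S → A → R × S → J → ℝ} {act : Q → ℕ → S → A → ℝ} {u π : ℕ → S → A → ℝ}
  {Cand : ℕ → ℕ → Finset Q} {Vis : ℕ → J → S → Prop} {C K : ℝ}

theorem segWeight_nonneg (hv : IsStepLaw v) (hπ : IsActionLaw π) (p : ℕ) (s' : S) (n : ℕ) (s : S) :
    0 ≤ segWeight v π p s' n s :=
  transport_nonneg (fun i => stepWeight_nonneg hv hπ (p + i)) s' n s

theorem segWeight_zero (p : ℕ) (s' : S) : segWeight v π p s' 0 s' = 1 :=
  if_pos rfl

theorem IsCover.exists_isCoveringGauge [Finite J] {H : ℕ} (h : IsCover v π act Vis Cand C H)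
    (hv : IsStepLaw v) (hact : ∀ ψ, IsActionLaw (act ψ)) (hπ : IsActionLaw π) {k p : ℕ}
    (hp : p + (k + 1) = H) {c : J → ℝ} {s' : S} (hvis : ∀ j, 0 < c j → Vis p j s')
    (hpos : ∃ j, 0 < c j) : ∃ κ μ, IsCoveringGauge v π act Cand C k p c s' κ μ := by
  classical
  let Live (i : ℕ) (s : S) : Prop := i ≤ k ∧ ∃ j, 0 < c j ∧ 0 < segWeight v π p s' i s j
  have hchoice (i : ℕ) (s : S) : ∃ x : J → ℝ, 0 ≤ x ∧ (¬ Live i s → x = 0) ∧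
      (Live i s → (∃ j, 0 < c j ∧ 0 < segWeight v π p s' i s j ∧
          segWeight v π p s' i s j ≤ C * x j) ∧
        ∃ ψ ∈ Cand p (p + i), x = segWeight v (act ψ) p s' i s) := by
    by_cases hlive : Live i s
    · have ⟨hi, j, hj, hseg⟩ := hlive
      obtain ⟨ψ, hψ, hle⟩ :=
        h.exists_le s (hp ▸ Nat.add_lt_add_left (Nat.lt_succ_of_le hi) p) (hvis j hj)
      exact ⟨_, segWeight_nonneg hv (hact ψ) p s' i s, fun hn => absurd hlive hn,
        fun _ => ⟨⟨j, hj, hseg, hle⟩, ψ, hψ, rfl⟩⟩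
    · exact ⟨0, le_rfl, fun _ => rfl, fun h => absurd h hlive⟩
  choose κ hκ hdead hκlive using hchoice
  have hκ₀ : κ 0 s' = 1 := by
    obtain ⟨j, hj⟩ := hpos
    obtain ⟨-, ψ, -, hψ⟩ := hκlive 0 s'
      ⟨k.zero_le, j, hj, by simp only [segWeight_zero, Pi.one_apply, zero_lt_one]⟩
    rw [hψ, segWeight_zero]
  obtain ⟨μ, hμ⟩ := exists_isGauge (fun i => stepWeight_nonneg hv hπ (p + i))
    (Set.toFinite (Function.support c)) hκ hκ₀
  have hgauge_pos {i s j} (hseg : 0 < segWeight v π p s' i s j)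
      (hle : segWeight v π p s' i s j ≤ C * κ i s j) : 0 < κ i s j :=
    (hκ i s j).lt_of_ne' (right_ne_zero_of_mul (hseg.trans_le hle).ne')
  refine ⟨κ, μ, hμ, fun i hi s j hj hseg => ?_, fun i _ s hs => ?_⟩
  · obtain ⟨⟨j, hj, hseg, hle⟩, -⟩ := hκlive i s ⟨hi, j, hj, hseg⟩
    exact ⟨j, hj.ne', (hgauge_pos hseg hle).ne'⟩
  · have hlive : Live i s := by
      by_contra hn
      obtain ⟨j, -, hj⟩ := hμ.exists_ne_zero_of_transport_ne_zero (hpos.imp fun j hj => hj.ne') hs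
      exact hj (congr_fun (hdead i s hn) j)
    obtain ⟨⟨j, hj, hseg, hle⟩, hcand⟩ := hκlive i s hlive
    refine ⟨le_of_mul_le_mul_right ?_ (hgauge_pos hseg hle), hcand⟩
    exact (hμ.transport_mul_le (fun i => stepWeight_nonneg hv hπ (p + i)) i s hj.ne').trans hle

theorem IsCoveringGauge.transport_mul_le_sum {k p : ℕ} {c : J → ℝ} {s' : S} {κ : ℕ → S → J → ℝ}
    {μ : ℕ → S → A → R × S → ℝ} (h : IsCoveringGauge v π act Cand C k p c s' κ μ) (hC : 0 ≤ C)
    {i : ℕ} (hi : i ≤ k) (s : S) {f : (J → ℝ) → ℝ} (hf : ∀ x, 0 ≤ f x) :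
    transport μ s' i s * f (κ i s) ≤
      C * ∑ ψ ∈ Cand p (p + i), f (segWeight v (act ψ) p s' i s) := by
  by_cases hs : transport μ s' i s = 0
  · rw [hs, zero_mul]
    exact mul_nonneg hC (Finset.sum_nonneg fun _ _ => hf _)
  · obtain ⟨hle, ψ, hψ, heq⟩ := h.candidate i hi s hs
    rw [heq]
    exact mul_le_mul hle (Finset.single_le_sum
      (f := fun ψ => f (segWeight v (act ψ) p s' i s)) (fun _ _ => hf _) hψ) (hf _) hC

variable [Fintype J]

/-- The weighted positive mass that the policy of the schedule `l` sees, with the sign of `l`. -/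
noncomputable def scheduleTerm (v : ℕ → S → A → R × S → J → ℝ) (act : Q → ℕ → S → A → ℝ)
    (u : ℕ → S → A → ℝ) (C K : ℝ) (k p : ℕ) (c : J → ℝ) (s : S) (l : List (Checkpoint Q)) : ℝ :=
  scheduleWeight C K l * posMass v (schedulePolicy act u l) k p (scheduleSign l • c) s

theorem scheduleTerm_nonneg (hC : 0 ≤ C) (hK : 0 ≤ K) (k p : ℕ) (c : J → ℝ) (s : S)
    (l : List (Checkpoint Q)) : 0 ≤ scheduleTerm v act u C K k p c s l :=
  mul_nonneg (scheduleWeight_nonneg hC hK l) (posMass_nonneg _ _ _ _)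

theorem scheduleTerm_nil (k p : ℕ) (c : J → ℝ) (s : S) :
    scheduleTerm v act u C K k p c s [] = posMass v (schedulePolicy act u []) k p c s := by
  simp only [scheduleTerm, scheduleWeight, scheduleSign, List.map_nil, List.prod_nil, one_mul,
    one_smul]

namespace IsCoveringGauge

variable {k p : ℕ} {c : J → ℝ} {s' : S} {κ : ℕ → S → J → ℝ} {μ : ℕ → S → A → R × S → ℝ}

theorem weight_mul_sum_posMass_random_le (h : IsCoveringGauge v π act Cand C k p c s' κ μ)
    (hC : 0 ≤ C) (hK : 0 < K) (hu : ∀ p s a, u p s a = K⁻¹) {i : ℕ} (hi : i ≤ k)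
    (l : List (Checkpoint Q)) :
    scheduleWeight C K l * ∑ s, transport μ s' i s * ∑ a, ∑ o : R × S,
        posMass v (schedulePolicy act u l) (k - i) (p + i + 1)
          (scheduleSign l • c * (κ i s * v (p + i) s a o)) o.2
      ≤ ∑ ψ ∈ Cand p (p + i), scheduleTerm v act u C K (k + 1) p c s' (⟨p + i, true, ψ⟩ :: l) := by
  calc _ ≤ scheduleWeight C K l * ∑ s, C * ∑ ψ ∈ Cand p (p + i), ∑ a, ∑ o : R × S,
        posMass v (schedulePolicy act u l) (k - i) (p + i + 1)
          (scheduleSign l • c * (segWeight v (act ψ) p s' i s * v (p + i) s a o)) o.2 := by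
        refine mul_le_mul_of_nonneg_left (Finset.sum_le_sum fun s _ => ?_)
          (scheduleWeight_nonneg hC hK.le l)
        exact h.transport_mul_le_sum hC hi s (f := fun x => ∑ a, ∑ o : R × S,
          posMass v (schedulePolicy act u l) (k - i) (p + i + 1)
            (scheduleSign l • c * (x * v (p + i) s a o)) o.2)
          fun x => Finset.sum_nonneg fun _ _ => Finset.sum_nonneg fun _ _ => posMass_nonneg _ _ _ _
    _ ≤ scheduleWeight C K l * (C * ∑ ψ ∈ Cand p (p + i), K *
        posMass v (schedulePolicy act u (⟨p + i, true, ψ⟩ :: l)) (k + 1) p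
          (scheduleSign l • c) s') := by
        rw [← Finset.mul_sum, Finset.sum_comm]
        refine mul_le_mul_of_nonneg_left (mul_le_mul_of_nonneg_left ?_ hC)
          (scheduleWeight_nonneg hC hK.le l)
        exact Finset.sum_le_sum fun ψ _ => sum_posMass_random_checkpoint_le hK hu hi p ψ l _ s'
    _ = _ := by
        simp only [Finset.mul_sum, scheduleTerm, scheduleWeight_cons, scheduleSign_cons, if_true,
          one_mul]
        exact Finset.sum_congr rfl fun ψ _ => by ring

theorem weight_mul_sum_posMass_le (h : IsCoveringGauge v π act Cand C k p c s' κ μ)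
    (hC : 0 ≤ C) (hK : 0 ≤ K) {i : ℕ} (hi : i < k) (l : List (Checkpoint Q)) :
    scheduleWeight C K l * ∑ s, transport μ s' (i + 1) s *
        posMass v (schedulePolicy act u l) (k - i) (p + i + 1)
          (-(scheduleSign l • c) * κ (i + 1) s) s
      ≤ ∑ ψ ∈ Cand p (p + i + 1),
          scheduleTerm v act u C K (k + 1) p c s' (⟨p + i, false, ψ⟩ :: l) := by
  calc _ ≤ scheduleWeight C K l * ∑ s, C * ∑ ψ ∈ Cand p (p + i + 1),
        posMass v (schedulePolicy act u l) (k - i) (p + i + 1)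
          (-(scheduleSign l • c) * segWeight v (act ψ) p s' (i + 1) s) s := by
        refine mul_le_mul_of_nonneg_left (Finset.sum_le_sum fun s _ => ?_)
          (scheduleWeight_nonneg hC hK l)
        exact h.transport_mul_le_sum hC (Nat.succ_le_of_lt hi) s (f := fun x =>
          posMass v (schedulePolicy act u l) (k - i) (p + i + 1) (-(scheduleSign l • c) * x) s)
          fun x => posMass_nonneg _ _ _ _
    _ ≤ scheduleWeight C K l * (C * ∑ ψ ∈ Cand p (p + i + 1),
        posMass v (schedulePolicy act u (⟨p + i, false, ψ⟩ :: l)) (k + 1) p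
          (-(scheduleSign l • c)) s') := by
        rw [← Finset.mul_sum, Finset.sum_comm]
        refine mul_le_mul_of_nonneg_left (mul_le_mul_of_nonneg_left ?_ hC)
          (scheduleWeight_nonneg hC hK l)
        exact Finset.sum_le_sum fun ψ _ => sum_posMass_checkpoint_le hi.le p ψ l _ s'
    _ = _ := by
        simp only [Finset.mul_sum, scheduleTerm, scheduleWeight_cons, scheduleSign_cons,
          Bool.false_eq_true, if_false, mul_one, neg_mul, one_mul, neg_smul]
        exact Finset.sum_congr rfl fun ψ _ => by ring

theorem sum_scheduleTerm_residual_le (h : IsCoveringGauge v π act Cand C k p c s' κ μ)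
    (hπ : IsActionLaw π) (hC : 0 ≤ C) (hK : 0 < K) (hu : ∀ p s a, u p s a = K⁻¹) {i : ℕ}
    (hi : i < k) (l : List (Checkpoint Q)) :
    ∑ s, transport μ s' i s * ∑ a, ∑ o : R × S, scheduleTerm v act u C K (k - i) (p + i + 1)
        (c * gaugeResidual (fun i => stepWeight v π (p + i)) κ μ i s a o) o.2 l
      ≤ (∑ ψ ∈ Cand p (p + i), scheduleTerm v act u C K (k + 1) p c s' (⟨p + i, true, ψ⟩ :: l)) +
        ∑ ψ ∈ Cand p (p + i + 1),
          scheduleTerm v act u C K (k + 1) p c s' (⟨p + i, false, ψ⟩ :: l) := by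
  have hpull : ∑ s, transport μ s' i s * ∑ a, ∑ o : R × S, scheduleTerm v act u C K (k - i)
        (p + i + 1) (c * gaugeResidual (fun i => stepWeight v π (p + i)) κ μ i s a o) o.2 l
      = scheduleWeight C K l * ∑ s, transport μ s' i s * ∑ a, ∑ o : R × S,
        posMass v (schedulePolicy act u l) (k - i) (p + i + 1) (scheduleSign l • c *
          gaugeResidual (fun i => stepWeight v π (p + i)) κ μ i s a o) o.2 := by
    simp only [scheduleTerm, ← Finset.mul_sum, mul_left_comm _ (scheduleWeight C K l),
      smul_mul_assoc]
  rw [hpull]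
  refine (mul_le_mul_of_nonneg_left (sum_transport_mul_posMass_residual_le h.scale_nonneg hπ κ s'
    (k - i) p (p + i + 1) i _) (scheduleWeight_nonneg hC hK.le l)).trans ?_
  rw [mul_add]
  exact add_le_add (h.weight_mul_sum_posMass_random_le hC hK hu hi.le l)
    (h.weight_mul_sum_posMass_le hC hK.le hi l)

theorem sum_transport_mul_posMass_last_le (h : IsCoveringGauge v π act Cand C k p c s' κ μ)
    (hπ : IsActionLaw π) (hC : 0 ≤ C) (hK : 0 < K) (hu : ∀ p s a, u p s a = K⁻¹) :
    ∑ s, transport μ s' k s * posMass v π 1 (p + k) (c * κ k s) s ≤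
      ∑ ψ ∈ Cand p (p + k), scheduleTerm v act u C K (k + 1) p c s' [⟨p + k, true, ψ⟩] := by
  refine le_trans ?_ (h.weight_mul_sum_posMass_random_le hC hK hu le_rfl [])
  simp only [scheduleWeight, scheduleSign, List.map_nil, List.prod_nil, one_mul, one_smul,
    Nat.sub_self, ← mul_assoc]
  exact Finset.sum_le_sum fun s _ =>
    mul_le_mul_of_nonneg_left (posMass_succ_le hπ 0 _ _ s) (transport_nonneg h.scale_nonneg s' k s)

/-- The gauge is tight for one context, which drops out of the residual, so that the bound `B` for
fewer contexts applies. -/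
theorem transport_mul_posMass_residual_le (h : IsCoveringGauge v π act Cand C k p c s' κ μ)
    (hv : IsStepLaw v) (hπ : IsActionLaw π) {H n : ℕ} (hcover : IsCover v π act Vis Cand C H)
    (hp : p + (k + 1) = H) (hvis : ∀ j, 0 < c j → Vis p j s')
    (hcard : (Function.support c).ncard ≤ n + 2) {i : ℕ} (hi : i < k) {B : (J → ℝ) → S → ℝ}
    (hB : ∀ c s, 0 ≤ B c s)
    (ih : ∀ c s, (∀ j, 0 < c j → Vis (p + i + 1) j s) → (Function.support c).ncard ≤ n + 1 →
      posMass v π (k - i) (p + i + 1) c s ≤ B c s) (s : S) (a : A) (o : R × S) :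
    transport μ s' i s * posMass v π (k - i) (p + i + 1)
        (c * gaugeResidual (fun i => stepWeight v π (p + i)) κ μ i s a o) o.2
      ≤ transport μ s' i s *
        B (c * gaugeResidual (fun i => stepWeight v π (p + i)) κ μ i s a o) o.2 := by
  by_cases hs : transport μ s' i s = 0
  · rw [hs, zero_mul, zero_mul]
  refine mul_le_mul_of_nonneg_left ?_ (transport_nonneg h.scale_nonneg s' i s)
  set r := gaugeResidual (fun i => stepWeight v π (p + i)) κ μ i s a o
  have hreach {j : J} (hj : 0 < (c * r) j) : 0 < c j ∧ 0 < segWeight v π p s' (i + 1) o.2 j := by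
    have hcj : j ∈ Function.support c := left_ne_zero_of_mul hj.ne'
    have hrj : r j ≠ 0 := right_ne_zero_of_mul hj.ne'
    exact ⟨pos_of_mul_pos_left hj (h.residual_nonneg i s a o hcj),
      h.transport_pos_of_residual_ne_zero (fun i => stepWeight_nonneg hv hπ (p + i)) hs hcj hrj⟩
  by_cases hlive : ∃ j ∈ Function.support c, κ (i + 1) o.2 j ≠ 0
  · refine ih _ _ (fun j hj => ?_) ?_
    · exact hcover.vis (n := i + 1) (by omega) (hvis j (hreach hj).1) (hreach hj).2
    · obtain ⟨j, hj, hrj⟩ := h.exists_residual_eq_zero i s a hlive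
      have hlt : (Function.support (c * r)).ncard < (Function.support c).ncard :=
        Set.ncard_lt_ncard ⟨fun j hj => left_ne_zero_of_mul hj,
          fun hsub => hsub hj (mul_eq_zero_of_right _ hrj)⟩ (Set.toFinite _)
      omega
  · rw [posMass_of_nonpos hv hπ]
    · exact hB _ _
    · intro j
      by_contra! hj
      exact hlive (h.live (i + 1) hi o.2 j (hreach hj).1 (hreach hj).2)

theorem posMass_succ_le_sum_scheduleTerm (h : IsCoveringGauge v π act Cand C k p c s' κ μ)
    (hπ : IsActionLaw π) (hC : 0 ≤ C) (hK : 0 < K) (hu : ∀ p s a, u p s a = K⁻¹) {n : ℕ}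
    (ih : ∀ i < k, ∀ s a (o : R × S),
      transport μ s' i s * posMass v π (k - i) (p + i + 1)
        (c * gaugeResidual (fun i => stepWeight v π (p + i)) κ μ i s a o) o.2 ≤
      transport μ s' i s * ∑ l ∈ schedules Cand n (k - i) (p + i + 1),
        scheduleTerm v act u C K (k - i) (p + i + 1)
          (c * gaugeResidual (fun i => stepWeight v π (p + i)) κ μ i s a o) o.2 l) :
    posMass v π (k + 1) p c s' ≤
      ∑ l ∈ schedules Cand (n + 1) (k + 1) p, scheduleTerm v act u C K (k + 1) p c s' l := by
  refine (posMass_le_sum_residual h.scale_nonneg h.init k p c le_rfl).trans ?_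
  rw [sum_schedules_succ, Finset.sum_range_succ, add_right_comm, ← Finset.sum_add_distrib,
    Nat.sub_self, schedules_zero_right, Nat.add_sub_cancel_left]
  simp only [Finset.sum_singleton]
  refine add_le_add (Finset.sum_le_sum fun i hi => ?_)
    (h.sum_transport_mul_posMass_last_le hπ hC hK hu)
  have hik := Finset.mem_range.1 hi
  rw [Finset.sum_comm (s := Cand p (p + i)), Finset.sum_comm (s := Cand p (p + i + 1)),
    ← Finset.sum_add_distrib]
  calc _ ≤ ∑ s, ∑ a, ∑ o : R × S, transport μ s' i s *
        ∑ l ∈ schedules Cand n (k - i) (p + i + 1), scheduleTerm v act u C K (k - i) (p + i + 1)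
          (c * gaugeResidual (fun i => stepWeight v π (p + i)) κ μ i s a o) o.2 l := by
        simp only [Finset.mul_sum (s := Finset.univ)]
        exact Finset.sum_le_sum fun s _ => Finset.sum_le_sum fun a _ =>
          Finset.sum_le_sum fun o _ => ih i hik s a o
    _ = ∑ l ∈ schedules Cand n (k - i) (p + i + 1), ∑ s, transport μ s' i s * ∑ a, ∑ o : R × S,
        scheduleTerm v act u C K (k - i) (p + i + 1)
          (c * gaugeResidual (fun i => stepWeight v π (p + i)) κ μ i s a o) o.2 l := by
        simp only [Finset.mul_sum, Finset.sum_comm (t := schedules Cand n (k - i) (p + i + 1))]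
    _ ≤ _ := Finset.sum_le_sum fun l _ => h.sum_scheduleTerm_residual_le hπ hC hK hu hik l

end IsCoveringGauge

theorem posMass_le_sum_scheduleTerm {H : ℕ} (hcover : IsCover v π act Vis Cand C H)
    (hv : IsStepLaw v) (hact : ∀ ψ, IsActionLaw (act ψ)) (hu : IsActionLaw u)
    (hu' : ∀ p s a, u p s a = K⁻¹) (hπ : IsActionLaw π) (hC : 0 ≤ C) (hK : 0 < K) :
    ∀ (n k p : ℕ) (c : J → ℝ) (s' : S), p + k = H → (∀ j, 0 < c j → Vis p j s') →
      (Function.support c).ncard ≤ n + 1 →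
      posMass v π k p c s' ≤ ∑ l ∈ schedules Cand n k p, scheduleTerm v act u C K k p c s' l := by
  have hbound (n k p : ℕ) (c : J → ℝ) (s' : S) :
      0 ≤ ∑ l ∈ schedules Cand n k p, scheduleTerm v act u C K k p c s' l :=
    Finset.sum_nonneg fun l _ => scheduleTerm_nonneg hC hK.le k p c s' l
  intro n
  induction n with
  | zero =>
    intro k p c s' _ _ hcard
    rw [schedules, Finset.sum_singleton, scheduleTerm_nil]
    exact (posMass_eq_of_subsingleton_support hv hπ (isActionLaw_schedulePolicy hact hu []) k p s'
      (Set.ncard_le_one_iff_subsingleton.1 hcard)).le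
  | succ n ih =>
    intro k p c s' hp hvis hcard
    obtain _ | k := k
    · rw [schedules, Finset.sum_singleton, scheduleTerm_nil]
      rfl
    by_cases hpos : ∃ j, 0 < c j
    swap
    · push Not at hpos
      exact (posMass_of_nonpos hv hπ _ _ _ hpos).trans_le (hbound _ _ _ _ _)
    obtain ⟨κ, μ, h⟩ := hcover.exists_isCoveringGauge hv hact hπ hp hvis hpos
    refine h.posMass_succ_le_sum_scheduleTerm hπ hC hK hu' fun i hi s a o => ?_
    exact h.transport_mul_posMass_residual_le hv hπ hcover hp hvis hcard hi
      (fun c s => hbound n (k - i) (p + i + 1) c s)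
      (fun c s => ih (k - i) (p + i + 1) c s (by omega)) s a o

end OffPolicy

/-! ### Two latent MDPs -/

section Trajectories

theorem sum_consEquiv {X : Type*} [Fintype X] {n : ℕ} (F : (Fin (n + 1) → X) → ℝ) :
    ∑ x, F x = ∑ y, ∑ x : Fin n → X, F (Fin.cons y x) := by
  rw [← (Fin.consEquiv (fun _ : Fin (n + 1) => X)).sum_comp, Fintype.sum_prod_type]
  rfl

theorem prevEntry_cons_succ {X : Type*} {n : ℕ} (o : Option X) (y : X) (x : Fin n → X)
    (t : Fin n) :
    prevEntry o (Fin.cons y x : Fin (n + 1) → X) t.succ = prevEntry (some y) x t := by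
  rcases t with ⟨_ | t, ht⟩ <;> simp only [prevEntry, Fin.succ_mk] <;> rfl

theorem prod_chain_cons {X : Type*} {n : ℕ} (f : ℕ → Option X → X → ℝ) (p : ℕ) (o : Option X)
    (y : X) (x : Fin n → X) :
    ∏ t : Fin (n + 1), f (p + t) (prevEntry o (Fin.cons y x : Fin (n + 1) → X) t)
        ((Fin.cons y x : Fin (n + 1) → X) t) =
      f p o y * ∏ t : Fin n, f (p + 1 + t) (prevEntry (some y) x t) (x t) := by
  rw [Fin.prod_univ_succ]
  simp only [Fin.cons_succ, prevEntry_cons_succ, Fin.val_succ, add_assoc, add_comm 1]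
  rfl

variable {S A R J : Type*}

/-- The weight of one step of a trajectory in the context `j`. -/
noncomputable def chainStep (T : J → Option (S × A) → PMF S) (rew : J → S → A → PMF R)
    (ν : ℕ → S → A → ℝ) (j : J) (p : ℕ) (o : Option (S × A × R)) (y : S × A × R) : ℝ :=
  (T j (o.map fun z => (z.1, z.2.1)) y.1).toReal * ν p y.1 y.2.1 *
    (rew j y.1 y.2.1 y.2.2).toReal

/-- The outcome probabilities for horizon `H` of a family of contexts. After the last time step the
state stays. -/
noncomputable def outcomeWeight (H : ℕ) (T : J → Option (S × A) → PMF S)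
    (rew : J → S → A → PMF R) (p : ℕ) (s : S) (a : A) (o : R × S) (j : J) : ℝ :=
  (rew j s a o.1).toReal *
    ((if p + 1 < H then T j (some (s, a)) else PMF.pure s) o.2).toReal

theorem sum_toReal_pmf {X : Type*} [Fintype X] (p : PMF X) : ∑ x, (p x).toReal = 1 := by
  rw [← ENNReal.toReal_sum fun x _ => p.apply_ne_top x, sum_pmf, ENNReal.toReal_one]

variable [Fintype S] [Fintype R]

theorem isStepLaw_outcomeWeight (H : ℕ) (T : J → Option (S × A) → PMF S)
    (rew : J → S → A → PMF R) : IsStepLaw (outcomeWeight H T rew) where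
  nonneg p s a o j := mul_nonneg ENNReal.toReal_nonneg ENNReal.toReal_nonneg
  sum_eq_one p s a := by
    funext j
    simp only [Finset.sum_apply, outcomeWeight, Fintype.sum_prod_type, ← Finset.mul_sum,
      sum_toReal_pmf, mul_one, Pi.one_apply]

variable [Fintype A] [Fintype J]

theorem posMass_one_outcomeWeight {H p : ℕ} (hp : p + 1 = H) (T : J → Option (S × A) → PMF S)
    (rew : J → S → A → PMF R) (ν : ℕ → S → A → ℝ) (c : J → ℝ) (s : S) :
    posMass (outcomeWeight H T rew) ν 1 p c s =
      ∑ a, ∑ r, max (∑ j, c j * (ν p s a * (rew j s a r).toReal)) 0 := by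
  classical
  simp only [posMass, Fintype.sum_prod_type, Pi.mul_apply, stepWeight, Pi.smul_apply, smul_eq_mul,
    outcomeWeight, hp, lt_irrefl, if_false, PMF.pure_apply]
  refine Finset.sum_congr rfl fun a _ => Finset.sum_congr rfl fun r _ => ?_
  rw [Finset.sum_eq_single s]
  · simp only [if_true, ENNReal.toReal_one, mul_one]
  · intro s' _ hs
    simp only [hs, if_false, ENNReal.toReal_zero, mul_zero, Finset.sum_const_zero, max_self]
  · exact fun hs => absurd (Finset.mem_univ s) hs

theorem sum_posMass_outcomeWeight {H : ℕ} (T : J → Option (S × A) → PMF S)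
    (rew : J → S → A → PMF R) (ν : ℕ → S → A → ℝ) :
    ∀ (k p : ℕ) (c : J → ℝ) (o : Option (S × A × R)), p + (k + 1) = H →
    ∑ s, posMass (outcomeWeight H T rew) ν (k + 1) p
        (c * fun j => (T j (o.map fun z => (z.1, z.2.1)) s).toReal) s =
      ∑ x : Fin (k + 1) → S × A × R, max (∑ j, c j * ∏ t : Fin (k + 1),
        chainStep T rew ν j (p + t) (prevEntry o x t) (x t)) 0 := by
  intro k
  induction k with
  | zero =>
    intro p c o hp
    rw [sum_consEquiv]
    have hcons (j : J) := prod_chain_cons (n := 0) (chainStep T rew ν j) p o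
    simp only [hcons]
    simp only [Fintype.sum_prod_type, posMass_one_outcomeWeight hp, Fintype.sum_unique,
      Fin.prod_univ_zero, mul_one, chainStep, Pi.mul_apply, mul_assoc]
  | succ k ih =>
    intro p c o hp
    have hstep (s : S) (a : A) (r : R) (s' : S) :
        c * (fun j => (T j (o.map fun z => (z.1, z.2.1)) s).toReal) *
            stepWeight (outcomeWeight H T rew) ν p s a (r, s') =
          (c * fun j => chainStep T rew ν j p o (s, a, r)) *
            fun j => (T j ((some (s, a, r)).map fun z => (z.1, z.2.1)) s').toReal := by
      funext j
      simp only [Pi.mul_apply, stepWeight, Pi.smul_apply, smul_eq_mul, outcomeWeight,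
        if_pos (show p + 1 < H by omega), chainStep, Option.map_some]
      ring
    rw [sum_consEquiv]
    have hcons (j : J) := prod_chain_cons (n := k + 1) (chainStep T rew ν j) p o
    simp only [hcons]
    rw [Fintype.sum_prod_type]
    refine Finset.sum_congr rfl fun s _ => ?_
    rw [posMass, Fintype.sum_prod_type]
    refine Finset.sum_congr rfl fun a _ => ?_
    rw [Fintype.sum_prod_type]
    refine Finset.sum_congr rfl fun r _ => ?_
    simp only [hstep]
    rw [ih (p + 1) _ (some (s, a, r)) (by omega)]
    simp only [Pi.mul_apply, mul_assoc]

end Trajectories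

section ModelPair

variable {S A R : Type*} [Fintype A] {M H : ℕ}

/-- The action probabilities of a policy, uniform from the horizon on. -/
noncomputable def actWeight (π : Policy S A H) (p : ℕ) (s : S) (a : A) : ℝ :=
  if h : p < H then (π ⟨p, h⟩ s a).toReal else (Fintype.card A : ℝ)⁻¹

theorem isActionLaw_actWeight [Nonempty A] (π : Policy S A H) : IsActionLaw (actWeight π) where
  nonneg p s a := by
    unfold actWeight
    split_ifs
    · exact ENNReal.toReal_nonneg
    · positivity
  sum_eq_one p s := by
    unfold actWeight
    split_ifs
    · exact sum_toReal_pmf _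
    · simp only [Finset.sum_const, Finset.card_univ, nsmul_eq_mul]
      exact mul_inv_cancel₀ (Nat.cast_ne_zero.2 Fintype.card_ne_zero)

variable [Fintype R]

/-- The outcome probabilities of the contexts of two models. -/
noncomputable def pairWeight (H : ℕ) (θ θ' : LMDP S A R M) :
    ℕ → S → A → R × S → Fin M ⊕ Fin M → ℝ :=
  outcomeWeight H (Sum.elim θ.T θ'.T) (Sum.elim θ.rew θ'.rew)

theorem sum_stepWeight_pairWeight_inl (θ θ' : LMDP S A R M) (m : Fin M) (π : Policy S A H) {p : ℕ}
    (hp : p + 1 < H) (s s' : S) :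
    ∑ a, ∑ r, stepWeight (pairWeight H θ θ') (actWeight π) p s a (r, s') (Sum.inl m) =
      ∑ a, (π ⟨p, by omega⟩ s a).toReal * (θ.T m (some (s, a)) s').toReal := by
  simp only [stepWeight, Pi.smul_apply, smul_eq_mul, pairWeight, outcomeWeight, if_pos hp,
    actWeight, dif_pos (show p < H by omega), Sum.elim_inl, ← Finset.mul_sum, ← Finset.sum_mul,
    sum_toReal_pmf, one_mul]

variable [Fintype S]

/-- The probabilities of the contexts of two models together with the initial state `s`, with a
negative sign for the second model. -/
noncomputable def initWeight (θ θ' : LMDP S A R M) (s : S) : Fin M ⊕ Fin M → ℝ :=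
  Sum.elim (fun m => (θ.w m).toReal) (fun m => -(θ'.w m).toReal) *
    fun j => (Sum.elim θ.T θ'.T j none s).toReal

theorem toReal_bind_apply {X Y : Type*} [Fintype X] (p : PMF X) (f : X → PMF Y) (y : Y) :
    (p.bind f y).toReal = ∑ x, (p x).toReal * (f x y).toReal := by
  rw [PMF.bind_apply, tsum_fintype, ENNReal.toReal_sum fun x _ =>
    ENNReal.mul_ne_top (PMF.apply_ne_top _ _) (PMF.apply_ne_top _ _)]
  simp only [ENNReal.toReal_mul]

theorem LMDP.law_toReal (θ : LMDP S A R M) (π : Policy S A H) (x : Trajectory S A R H) :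
    (θ.law π x).toReal =
      ∑ m, (θ.w m).toReal *
        ∏ t : Fin H, chainStep θ.T θ.rew (actWeight π) m t (prevEntry none x t) (x t) := by
  simp only [LMDP.law, toReal_bind_apply, ENNReal.toReal_mul, LMDP.contextLaw,
    PMF.ofFintype_apply, ENNReal.toReal_prod, LMDP.stepProb, chainStep, actWeight, Fin.is_lt,
    dif_pos]

theorem two_mul_sum_max_eq_tvDist {X : Type*} [Fintype X] (p q : PMF X) :
    2 * ∑ x, max ((p x).toReal - (q x).toReal) 0 = tvDist p q := by
  have hzero : ∑ x, ((p x).toReal - (q x).toReal) = 0 := by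
    rw [Finset.sum_sub_distrib, sum_toReal_pmf, sum_toReal_pmf, sub_self]
  have hmax (d : ℝ) : 2 * max d 0 = |d| + d := by
    rw [abs_add_eq_two_nsmul_posPart, nsmul_eq_mul, Nat.cast_ofNat, posPart_def]
  simp only [Finset.mul_sum, hmax, Finset.sum_add_distrib, hzero, add_zero, tvDist]

theorem tvDist_comm {X : Type*} [Fintype X] (p q : PMF X) : tvDist p q = tvDist q p :=
  Finset.sum_congr rfl fun _ _ => abs_sub_comm _ _

theorem sum_posMass_initWeight (hH : 0 < H) (θ θ' : LMDP S A R M) (π : Policy S A H) (e : ℝ) :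
    ∑ s, posMass (pairWeight H θ θ') (actWeight π) H 0 (e • initWeight θ θ' s) s =
      ∑ x, max (e * ((θ.law π x).toReal - (θ'.law π x).toReal)) 0 := by
  obtain ⟨k, rfl⟩ := Nat.exists_eq_succ_of_ne_zero hH.ne'
  simp only [initWeight, ← smul_mul_assoc]
  refine (sum_posMass_outcomeWeight _ _ (actWeight π) k 0 _ none (zero_add _)).trans ?_
  simp only [LMDP.law_toReal, Fintype.sum_sum_type, Pi.smul_apply, smul_eq_mul, Sum.elim_inl,
    Sum.elim_inr, zero_add, mul_add, Finset.mul_sum, mul_neg, neg_mul, Finset.sum_neg_distrib,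
    sub_eq_add_neg, mul_assoc, chainStep]

theorem two_mul_sum_posMass_initWeight (hH : 0 < H) (θ θ' : LMDP S A R M) (π : Policy S A H)
    {e : ℝ} (he : e = 1 ∨ e = -1) :
    2 * ∑ s, posMass (pairWeight H θ θ') (actWeight π) H 0 (e • initWeight θ θ' s) s =
      tvDist (θ.law π) (θ'.law π) := by
  rw [sum_posMass_initWeight hH]
  rcases he with rfl | rfl
  · simp only [one_mul, two_mul_sum_max_eq_tvDist]
  · rw [tvDist_comm, ← two_mul_sum_max_eq_tvDist]
    simp only [neg_mul, one_mul, neg_sub]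

theorem segWeight_eq_stateFrom (θ θ' : LMDP S A R M) (m : Fin M) (π : Policy S A H) (p : ℕ)
    (s' : S) : ∀ n s, p + n < H →
    segWeight (pairWeight H θ θ') (actWeight π) p s' n s (Sum.inl m) =
      (θ.stateFrom m π p s' n s).toReal := by
  classical
  intro n
  induction n with
  | zero =>
    intro s _
    simp only [segWeight, transport, LMDP.stateFrom, PMF.pure_apply]
    split_ifs
    exacts [ENNReal.toReal_one.symm, ENNReal.toReal_zero.symm]
  | succ n ih =>
    intro s hn
    simp only [segWeight, transport, LMDP.stateFrom, toReal_bind_apply, Finset.sum_apply,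
      Pi.mul_apply, dif_pos (show p + n < H by omega),
      sum_stepWeight_pairWeight_inl θ θ' m π (show p + n + 1 < H from hn)]
    exact Finset.sum_congr rfl fun s _ => congrArg (· * _) (ih s (by omega))

end ModelPair

section Reach

variable {S A R : Type*} {M H : ℕ}

/-- The entry before index `t` of an infinite sequence. -/
def prevTerm {X : Type*} (y : ℕ → X) (t : ℕ) : Option X :=
  if t = 0 then none else some (y (t - 1))

theorem prevTerm_update {X : Type*} (y : ℕ → X) {t n : ℕ} (h : t ≤ n) (x : X) :
    prevTerm (Function.update y n x) t = prevTerm y t := by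
  unfold prevTerm
  split_ifs
  · rfl
  · rw [Function.update_of_ne (by omega)]

/-- The first `n` entries of `y` are a possible beginning of a trajectory. -/
def LMDP.IsPath (θ : LMDP S A R M) (m : Fin M) (π : Policy S A H) (n : ℕ) (y : ℕ → S × A × R) :
    Prop :=
  ∀ t (h : t < H), t < n → θ.stepProb m π ⟨t, h⟩ (prevTerm y t) (y t) ≠ 0

/-- The state `s` can be reached at time index `p`. -/
def LMDP.Reach (θ : LMDP S A R M) (m : Fin M) (π : Policy S A H) (p : ℕ) (s : S) : Prop :=
  ∃ y : ℕ → S × A × R, θ.IsPath m π p y ∧ θ.T m ((prevTerm y p).map fun z => (z.1, z.2.1)) s ≠ 0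

variable {θ : LMDP S A R M} {m : Fin M} {π : Policy S A H} {p : ℕ}

theorem LMDP.IsPath.update {n : ℕ} {y : ℕ → S × A × R} (h : θ.IsPath m π n y) (hn : n < H)
    {x : S × A × R} (hx : θ.stepProb m π ⟨n, hn⟩ (prevTerm y n) x ≠ 0) :
    θ.IsPath m π (n + 1) (Function.update y n x) := by
  intro t ht htn
  rw [prevTerm_update y (Nat.le_of_lt_succ htn)]
  rcases Nat.lt_succ_iff_lt_or_eq.1 htn with hlt | rfl
  · rw [Function.update_of_ne hlt.ne]
    exact h t ht hlt
  · rwa [Function.update_self]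

theorem LMDP.exists_stepProb_ne_zero (θ : LMDP S A R M) (m : Fin M) (π : Policy S A H) (t : Fin H)
    (o : Option (S × A × R)) : ∃ x, θ.stepProb m π t o x ≠ 0 := by
  obtain ⟨s, hs⟩ := (θ.T m (o.map fun z => (z.1, z.2.1))).support_nonempty
  obtain ⟨a, ha⟩ := (π t s).support_nonempty
  obtain ⟨r, hr⟩ := (θ.rew m s a).support_nonempty
  exact ⟨(s, a, r), mul_ne_zero (mul_ne_zero hs ha) hr⟩

theorem LMDP.IsPath.exists_isPath_horizon {n : ℕ} {y : ℕ → S × A × R} (h : θ.IsPath m π n y)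
    (hn : n ≤ H) : ∃ z, θ.IsPath m π H z ∧ ∀ t < n, z t = y t := by
  suffices ∀ N, n ≤ N → N ≤ H → ∃ z, θ.IsPath m π N z ∧ ∀ t < n, z t = y t from this H hn le_rfl
  intro N hnN
  induction N, hnN using Nat.le_induction with
  | base => exact fun _ => ⟨y, h, fun _ _ => rfl⟩
  | succ N hnN ih =>
    intro hN
    obtain ⟨z, hz, hzy⟩ := ih (Nat.le_of_succ_le hN)
    obtain ⟨x, hx⟩ := θ.exists_stepProb_ne_zero m π ⟨N, hN⟩ (prevTerm z N)
    refine ⟨_, hz.update hN hx, fun t ht => ?_⟩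
    rw [Function.update_of_ne (ht.trans_le hnN).ne, hzy t ht]

theorem LMDP.Reach.succ {s s' : S} (h : θ.Reach m π p s) (hp : p < H) {a : A}
    (ha : π ⟨p, hp⟩ s a ≠ 0) (hT : θ.T m (some (s, a)) s' ≠ 0) : θ.Reach m π (p + 1) s' := by
  obtain ⟨y, hy, hs⟩ := h
  obtain ⟨r, hr⟩ := (θ.rew m s a).support_nonempty
  refine ⟨_, hy.update hp (x := (s, a, r)) (mul_ne_zero (mul_ne_zero hs ha) hr), ?_⟩
  rwa [prevTerm, if_neg p.succ_ne_zero, Nat.add_sub_cancel, Function.update_self]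

theorem LMDP.Reach.of_stateFrom_ne_zero {s' : S} (h : θ.Reach m π p s') :
    ∀ n s, p + n < H → θ.stateFrom m π p s' n s ≠ 0 → θ.Reach m π (p + n) s := by
  intro n
  induction n with
  | zero =>
    intro s _ hs
    exact (PMF.mem_support_pure_iff _ _).1 ((PMF.mem_support_iff _ _).2 hs) ▸ h
  | succ n ih =>
    intro s'' hn hs''
    have hp : p + n < H := by omega
    simp only [LMDP.stateFrom, dif_pos hp, ← PMF.mem_support_iff, PMF.mem_support_bind_iff] at hs''
    obtain ⟨s, hs, a, ha, hT⟩ := hs''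
    exact (ih s hp hs).succ hp ha hT

variable [Fintype S] [Fintype A] [Fintype R]

theorem LMDP.IsPath.contextLaw_ne_zero {y : ℕ → S × A × R} (h : θ.IsPath m π H y) :
    θ.contextLaw m π (fun t => y t) ≠ 0 := by
  rw [LMDP.contextLaw, PMF.ofFintype_apply, Finset.prod_ne_zero_iff]
  exact fun t _ => h t t.2 t.2

theorem LMDP.Reach.visitProb_pos {s : S} (h : θ.Reach m π p s) (hp : p < H) :
    0 < θ.visitProb m π ⟨p, hp⟩ s := by
  obtain ⟨y, hy, hs⟩ := h
  obtain ⟨a, ha⟩ := (π ⟨p, hp⟩ s).support_nonempty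
  obtain ⟨r, hr⟩ := (θ.rew m s a).support_nonempty
  obtain ⟨z, hz, hzy⟩ := (hy.update hp (x := (s, a, r))
    (mul_ne_zero (mul_ne_zero hs ha) hr)).exists_isPath_horizon hp
  rw [pos_iff_ne_zero, LMDP.visitProb, Ne, PMF.toOuterMeasure_apply_eq_zero_iff,
    Set.not_disjoint_iff]
  refine ⟨fun t => z t, hz.contextLaw_ne_zero, ?_⟩
  exact congrArg Prod.fst ((hzy p p.lt_succ_self).trans (Function.update_self ..))

theorem LMDP.Reach.of_segWeight_pos (θ' : LMDP S A R M) {s' s : S} (h : θ.Reach m π p s') {n : ℕ}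
    (hn : p + n < H)
    (hpos : 0 < segWeight (pairWeight H θ θ') (actWeight π) p s' n s (Sum.inl m)) :
    θ.Reach m π (p + n) s := by
  rw [segWeight_eq_stateFrom θ θ' m π p s' n s hn] at hpos
  exact h.of_stateFrom_ne_zero n s hn (ENNReal.toReal_ne_zero.1 hpos.ne').1

end Reach

/-! ### Segmented policies -/

section Schedules

variable {S A Q : Type*} {Cand : ℕ → ℕ → Finset Q}

theorem schedules_induction {P : ℕ → ℕ → List (Checkpoint Q) → Prop} (nil : ∀ n p, P n p [])
    (cons : ∀ n k p e l, e ∈ firstCheckpoints Cand k p →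
      l ∈ schedules Cand n (p + k - e.time) (e.time + 1) → P n (e.time + 1) l →
      P (n + 1) p (e :: l)) :
    ∀ {n k p l}, l ∈ schedules Cand n k p → P n p l
  | 0, _, p, l, hl => Finset.mem_singleton.1 hl ▸ nil 0 p
  | n + 1, 0, p, l, hl => Finset.mem_singleton.1 hl ▸ nil (n + 1) p
  | n + 1, k + 1, p, l, hl => by
    simp only [schedules, Finset.mem_biUnion, Finset.mem_image] at hl
    obtain ⟨e, he, l, hl, rfl⟩ := hl
    exact cons n k p e l he hl (schedules_induction nil cons hl)

theorem time_mem_Ico_of_mem_firstCheckpoints {k p : ℕ} {e : Checkpoint Q}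
    (he : e ∈ firstCheckpoints Cand k p) : e.time ∈ Set.Ico p (p + (k + 1)) := by
  simp only [firstCheckpoints, Finset.mem_union, Finset.mem_image, Finset.mem_sigma,
    Finset.mem_range] at he
  rcases he with ⟨x, ⟨hx, _⟩, rfl⟩ | ⟨x, ⟨hx, _⟩, rfl⟩ <;> constructor <;> dsimp only <;> omega

theorem policy_mem_of_mem_firstCheckpoints {Ψ : Finset Q} (hCand : ∀ p q, Cand p q ⊆ Ψ) {k p : ℕ}
    {e : Checkpoint Q} (he : e ∈ firstCheckpoints Cand k p) : e.policy ∈ Ψ := by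
  simp only [firstCheckpoints, Finset.mem_union, Finset.mem_image, Finset.mem_sigma] at he
  rcases he with ⟨x, ⟨_, hx⟩, rfl⟩ | ⟨x, ⟨_, hx⟩, rfl⟩ <;> exact hCand _ _ hx

theorem policy_mem_of_mem_schedules {Ψ : Finset Q} (hCand : ∀ p q, Cand p q ⊆ Ψ) {n k p : ℕ}
    {l : List (Checkpoint Q)} (hl : l ∈ schedules Cand n k p) : ∀ e ∈ l, e.policy ∈ Ψ := by
  refine schedules_induction (P := fun _ _ l => ∀ e ∈ l, e.policy ∈ Ψ)
    (fun _ _ => List.forall_mem_nil _) (fun n k p e l he _ ih => ?_) hl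
  exact List.forall_mem_cons.2 ⟨policy_mem_of_mem_firstCheckpoints hCand he, ih⟩

theorem length_le_of_mem_schedules {n k p : ℕ} {l : List (Checkpoint Q)}
    (hl : l ∈ schedules Cand n k p) : l.length ≤ n :=
  schedules_induction (P := fun n _ l => l.length ≤ n) (fun _ _ => Nat.zero_le _)
    (fun _ _ _ _ _ _ _ ih => Nat.succ_le_succ ih) hl

theorem time_mem_Ico_of_mem_schedules : ∀ {n k p : ℕ} {l : List (Checkpoint Q)},
    l ∈ schedules Cand n k p → ∀ e ∈ l, e.time ∈ Set.Ico p (p + k)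
  | 0, _, _, _, hl => Finset.mem_singleton.1 hl ▸ List.forall_mem_nil _
  | _ + 1, 0, _, _, hl => Finset.mem_singleton.1 hl ▸ List.forall_mem_nil _
  | n + 1, k + 1, p, l, hl => by
    simp only [schedules, Finset.mem_biUnion, Finset.mem_image] at hl
    obtain ⟨e, he, l, hl, rfl⟩ := hl
    have hp := time_mem_Ico_of_mem_firstCheckpoints he
    refine List.forall_mem_cons.2 ⟨hp, fun e' he' => ?_⟩
    have := time_mem_Ico_of_mem_schedules hl e' he'
    simp only [Set.mem_Ico] at *
    omega

theorem sortedLT_of_mem_schedules {n k p : ℕ} {l : List (Checkpoint Q)}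
    (hl : l ∈ schedules Cand n k p) : (l.map Checkpoint.time).SortedLT := by
  refine schedules_induction (P := fun _ _ l => (l.map Checkpoint.time).SortedLT)
    (fun _ _ => List.Pairwise.nil.sortedLT) (fun n k p e l _ hl ih => ?_) hl
  refine (List.pairwise_cons.2 ⟨?_, ih.pairwise⟩).sortedLT
  exact List.forall_mem_map.2 fun e' he' => (time_mem_Ico_of_mem_schedules hl e' he').1

theorem ne_nil_of_mem_schedules {n k p : ℕ} {l : List (Checkpoint Q)}
    (hl : l ∈ schedules Cand (n + 1) (k + 1) p) : l ≠ [] := by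
  simp only [schedules, Finset.mem_biUnion, Finset.mem_image] at hl
  obtain ⟨e, _, l, _, rfl⟩ := hl
  exact List.cons_ne_nil e l

/-- The lists of checkpoints that describe a segmented policy. -/
structure IsSchedule (H d : ℕ) (l : List (Checkpoint Q)) : Prop where
  sortedLT : (l.map Checkpoint.time).SortedLT
  time_lt : ∀ e ∈ l, e.time < H
  length_le : l.length ≤ d
  ne_nil : l ≠ []

theorem isSchedule_of_mem_schedules {H d : ℕ} (hH : H ≠ 0) (hd : d ≠ 0)
    {l : List (Checkpoint Q)} (hl : l ∈ schedules Cand d H 0) : IsSchedule H d l := by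
  obtain ⟨H, rfl⟩ := Nat.exists_eq_succ_of_ne_zero hH
  obtain ⟨d, rfl⟩ := Nat.exists_eq_succ_of_ne_zero hd
  exact ⟨sortedLT_of_mem_schedules hl,
    fun e he => (time_mem_Ico_of_mem_schedules hl e he).2.trans_eq (zero_add _),
    length_le_of_mem_schedules hl, ne_nil_of_mem_schedules hl⟩

/-- The action at time `q` is random. -/
def IsRandomAt (l : List (Checkpoint Q)) (q : ℕ) : Prop :=
  ∃ e ∈ l, e.time = q ∧ e.random = true

theorem isRandomAt_cons_iff {e : Checkpoint Q} {l : List (Checkpoint Q)} {q : ℕ} :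
    IsRandomAt (e :: l) q ↔ (e.time = q ∧ e.random = true) ∨ IsRandomAt l q := by
  simp only [IsRandomAt, List.mem_cons, exists_eq_or_imp]

theorem schedulePolicy_of_isRandomAt (act : Q → ℕ → S → A → ℝ) (u : ℕ → S → A → ℝ) {q : ℕ} :
    ∀ {l : List (Checkpoint Q)}, (l.map Checkpoint.time).SortedLT → IsRandomAt l q →
      schedulePolicy act u l q = u q
  | [], _, h => h.elim fun _ he => absurd he.1 List.not_mem_nil
  | e :: l, hl, h => by
    obtain ⟨hlt, hl⟩ := List.pairwise_cons.1 hl.pairwise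
    rcases isRandomAt_cons_iff.1 h with ⟨rfl, he⟩ | h
    · rw [schedulePolicy_cons_time, if_pos he]
    · obtain ⟨e', he', rfl, _⟩ := id h
      rw [schedulePolicy_cons_of_gt act u l (hlt _ (List.mem_map_of_mem he')),
        schedulePolicy_of_isRandomAt act u hl.sortedLT h]

theorem countP_time_lt_cons {e : Checkpoint Q} {l : List (Checkpoint Q)} {q : ℕ}
    (hl : ((e :: l).map Checkpoint.time).SortedLT) (hq : q ≤ e.time) :
    ((e :: l).map Checkpoint.time).countP (· < q) = 0 := by
  refine List.countP_eq_zero.2 (List.forall_mem_cons.2 ⟨by simpa using hq, fun t ht => ?_⟩)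
  have := (List.pairwise_cons.1 hl.pairwise).1 t ht
  simp only [decide_eq_true_eq, not_lt]
  omega

theorem schedulePolicy_of_not_isRandomAt (act : Q → ℕ → S → A → ℝ) (u : ℕ → S → A → ℝ) {q : ℕ} :
    ∀ {l : List (Checkpoint Q)}, (l.map Checkpoint.time).SortedLT → ¬ IsRandomAt l q →
      schedulePolicy act u l q =
        (l[(l.map Checkpoint.time).countP (· < q)]?).elim (u q) fun e => act e.policy q
  | [], _, _ => rfl
  | e :: l, hl, h => by
    rw [isRandomAt_cons_iff, not_or] at h
    rcases lt_or_ge e.time q with hq | hq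
    · rw [schedulePolicy_cons_of_gt act u l hq, List.map_cons,
        List.countP_cons_of_pos (by simpa using hq), List.getElem?_cons_succ,
        schedulePolicy_of_not_isRandomAt act u (List.pairwise_cons.1 hl.pairwise).2.sortedLT h.2]
    · rw [countP_time_lt_cons hl hq, List.getElem?_cons_zero, Option.elim_some]
      rcases hq.lt_or_eq with hq | rfl
      · exact schedulePolicy_cons_of_lt act u l hq
      · rw [schedulePolicy_cons_time, if_neg fun he => h.1 ⟨rfl, he⟩]

theorem isRandomAt_time_iff {l : List (Checkpoint Q)} (hl : (l.map Checkpoint.time).SortedLT)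
    {e : Checkpoint Q} (he : e ∈ l) : IsRandomAt l e.time ↔ e.random = true := by
  refine ⟨?_, fun h => ⟨e, he, rfl, h⟩⟩
  rintro ⟨e', he', ht, h⟩
  rwa [← List.inj_on_of_nodup_map hl.nodup he' he ht]

theorem schedule_ext {l l' : List (Checkpoint Q)} (hl : (l.map Checkpoint.time).SortedLT)
    (hl' : (l'.map Checkpoint.time).SortedLT)
    (htime : ∀ q, q ∈ l.map Checkpoint.time ↔ q ∈ l'.map Checkpoint.time)
    (hrandom : ∀ q, IsRandomAt l q ↔ IsRandomAt l' q)
    (hpolicy : ∀ i (hi : i < l.length) (hi' : i < l'.length), l[i].policy = l'[i].policy) :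
    l = l' := by
  have hmap : l.map Checkpoint.time = l'.map Checkpoint.time := hl.eq_of_mem_iff hl' htime
  have hlen : l.length = l'.length := by
    simpa only [List.length_map] using congrArg List.length hmap
  refine List.ext_getElem hlen fun i hi hi' => ?_
  have ht : l[i].time = l'[i].time := by
    simpa only [List.getElem?_map, List.getElem?_eq_getElem hi, List.getElem?_eq_getElem hi',
      Option.map_some, Option.some.injEq] using congrArg (fun t => t[i]?) hmap
  have hr : l[i].random = l'[i].random := by
    rw [Bool.eq_iff_iff, ← isRandomAt_time_iff hl (List.getElem_mem hi),
      ← isRandomAt_time_iff hl' (List.getElem_mem hi'), ht, hrandom]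
  have hp := hpolicy i hi hi'
  generalize l[i] = e at ht hr hp ⊢
  generalize l'[i] = e' at ht hr hp ⊢
  cases e
  cases e'
  exact Checkpoint.mk.injEq .. ▸ ⟨ht, hr, hp⟩

end Schedules

section ScheduleQueries

variable {S A : Type*} {H d : ℕ}

open Classical in
/-- The time steps of the checkpoints. -/
noncomputable def scheduleTimes (H : ℕ) {Q : Type*} (l : List (Checkpoint Q)) : Finset (Fin H) :=
  Finset.univ.filter fun t => t.1 ∈ l.map Checkpoint.time

theorem mem_scheduleTimes {Q : Type*} {l : List (Checkpoint Q)} {t : Fin H} :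
    t ∈ scheduleTimes H l ↔ t.1 ∈ l.map Checkpoint.time := by
  rw [scheduleTimes, Finset.mem_filter_univ]

theorem IsSchedule.card_filter_scheduleTimes {Q : Type*} {l : List (Checkpoint Q)}
    (hl : IsSchedule H d l) (P : ℕ → Prop) [DecidablePred P] :
    ((scheduleTimes H l).filter fun t => P t.1).card = (l.map Checkpoint.time).countP P := by
  have h : ((scheduleTimes H l).filter fun t => P t.1).map Fin.valEmbedding =
      ((l.map Checkpoint.time).filter P).toFinset := by
    ext q
    simp only [mem_scheduleTimes, Finset.mem_map, Finset.mem_filter, Fin.valEmbedding_apply,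
      List.mem_toFinset, List.mem_filter, decide_eq_true_eq]
    constructor
    · rintro ⟨t, ht, rfl⟩
      exact ht
    · rintro ⟨hq, hP⟩
      obtain ⟨e, he, rfl⟩ := List.mem_map.1 hq
      exact ⟨⟨e.time, hl.time_lt e he⟩, ⟨hq, hP⟩, rfl⟩
  rw [← Finset.card_map Fin.valEmbedding, h,
    List.toFinset_card_of_nodup (hl.sortedLT.nodup.filter _), List.countP_eq_length_filter]

theorem IsSchedule.scheduleTimes_nonempty_and_card_le {Q : Type*} {l : List (Checkpoint Q)}
    (hl : IsSchedule H d l) : (scheduleTimes H l).Nonempty ∧ (scheduleTimes H l).card ≤ d := by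
  constructor
  · obtain ⟨e, he⟩ := List.exists_mem_of_ne_nil l hl.ne_nil
    exact ⟨⟨e.time, hl.time_lt e he⟩, mem_scheduleTimes.2 (List.mem_map_of_mem he)⟩
  · have hcard := hl.card_filter_scheduleTimes fun _ => True
    rw [Finset.filter_true] at hcard
    exact hcard.trans_le
      (List.countP_le_length.trans (by simpa only [List.length_map] using hl.length_le))

open Classical in
/-- The checkpoints of a schedule with their random bits, as in a segmented policy. -/
noncomputable def IsSchedule.switching {Q : Type*} {l : List (Checkpoint Q)}
    (hl : IsSchedule H d l) : Switching H d :=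
  ⟨⟨scheduleTimes H l, hl.scheduleTimes_nonempty_and_card_le⟩, fun t => decide (IsRandomAt l t.1)⟩

theorem IsSchedule.exists_switching_iff {Q : Type*} {l : List (Checkpoint Q)}
    (hl : IsSchedule H d l) (t : Fin H) :
    (∃ ht : t ∈ hl.switching.1.1, hl.switching.2 ⟨t, ht⟩ = true) ↔ IsRandomAt l t := by
  classical
  constructor
  · rintro ⟨_, h⟩
    exact of_decide_eq_true h
  · intro h
    obtain ⟨e, he, ht, _⟩ := id h
    exact ⟨mem_scheduleTimes.2 (ht ▸ List.mem_map_of_mem he), decide_eq_true h⟩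

theorem IsRandomAt.time_lt {Q : Type*} {l : List (Checkpoint Q)} {q : ℕ} (h : IsRandomAt l q)
    (hl : IsSchedule H d l) : q < H := by
  obtain ⟨e, he, rfl, _⟩ := h
  exact hl.time_lt e he

variable [Fintype A] [Nonempty A]

/-- The policies `(ψ_0, …, ψ_{d-1})` of a schedule, completed by the uniform policy. -/
noncomputable def scheduleTuple (d : ℕ) (l : List (Checkpoint (Policy S A H))) :
    Fin d → Policy S A H :=
  fun i => (l[i.1]?).elim unifPolicy Checkpoint.policy

theorem IsSchedule.eq_of_switching_eq {l l' : List (Checkpoint (Policy S A H))}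
    (hl : IsSchedule H d l) (hl' : IsSchedule H d l') (hψ : scheduleTuple d l = scheduleTuple d l')
    (hτ : hl.switching = hl'.switching) : l = l' := by
  refine schedule_ext hl.sortedLT hl'.sortedLT (fun q => ?_) (fun q => ?_) fun i hi hi' => ?_
  · have htimes : scheduleTimes H l = scheduleTimes H l' := congrArg (fun c => c.1.1) hτ
    by_cases hq : q < H
    · simpa only [mem_scheduleTimes] using Finset.ext_iff.1 htimes ⟨q, hq⟩
    · have hnot {l : List (Checkpoint (Policy S A H))} (hl : IsSchedule H d l) :
          q ∉ l.map Checkpoint.time := fun h => by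
        obtain ⟨e, he, rfl⟩ := List.mem_map.1 h
        exact hq (hl.time_lt e he)
      exact iff_of_false (hnot hl) (hnot hl')
  · by_cases hq : q < H
    · rw [← hl.exists_switching_iff ⟨q, hq⟩, hτ, hl'.exists_switching_iff]
    · exact iff_of_false (fun h => hq (h.time_lt hl)) fun h => hq (h.time_lt hl')
  · have := congrFun hψ ⟨i, hi.trans_le hl.length_le⟩
    simpa only [scheduleTuple, List.getElem?_eq_getElem hi, List.getElem?_eq_getElem hi',
      Option.elim_some] using this

theorem snoc_scheduleTuple {l : List (Checkpoint (Policy S A H))} (hd : l.length ≤ d)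
    (i : Fin (d + 1)) :
    (Fin.snoc (scheduleTuple d l) unifPolicy : Fin (d + 1) → Policy S A H) i =
      (l[i.1]?).elim unifPolicy Checkpoint.policy := by
  induction i using Fin.lastCases with
  | last => rw [Fin.snoc_last, Fin.val_last, List.getElem?_eq_none hd, Option.elim_none]
  | cast i => rw [Fin.snoc_castSucc, scheduleTuple, Fin.val_castSucc]

open Classical in
/-- The policy following a list of checkpoints, with uniformly random actions; for a schedule this
is a segmented policy. -/
noncomputable def executedPolicy (l : List (Checkpoint (Policy S A H))) : Policy S A H := fun t =>
  (if IsRandomAt l t then unifPolicy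
    else (l[(l.map Checkpoint.time).countP (· < t.1)]?).elim unifPolicy Checkpoint.policy) t

theorem IsSchedule.segmented_eq_executedPolicy {l : List (Checkpoint (Policy S A H))}
    (hl : IsSchedule H d l) :
    segmented (Fin.snoc (scheduleTuple d l) unifPolicy) hl.switching = executedPolicy l := by
  funext t
  classical
  rw [segmented, executedPolicy]
  simp only [snoc_scheduleTuple hl.length_le]
  rw [← hl.card_filter_scheduleTimes fun q => q < t.1]
  rw [ite_apply]
  exact if_congr (hl.exists_switching_iff t) rfl rfl

theorem actWeight_executedPolicy {l : List (Checkpoint (Policy S A H))}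
    (hl : (l.map Checkpoint.time).SortedLT) (q : ℕ) :
    actWeight (executedPolicy l) q =
      schedulePolicy actWeight (actWeight (unifPolicy : Policy S A H)) l q := by
  classical
  have hexec : actWeight (executedPolicy l) q = actWeight (if IsRandomAt l q then unifPolicy
      else (l[(l.map Checkpoint.time).countP (· < q)]?).elim unifPolicy Checkpoint.policy) q := by
    funext s a
    by_cases hq : q < H
    · simp only [actWeight, dif_pos hq, executedPolicy]
    · simp only [actWeight, dif_neg hq]
  rw [hexec]
  by_cases h : IsRandomAt l q
  · rw [schedulePolicy_of_isRandomAt _ _ hl h, if_pos h]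
  · rw [schedulePolicy_of_not_isRandomAt _ _ hl h, if_neg h]
    cases l[(l.map Checkpoint.time).countP (· < q)]? <;> rfl

theorem executedPolicy_eq_unifPolicy {l : List (Checkpoint (Policy S A H))}
    (hl : ∀ e ∈ l, e.policy = unifPolicy) : executedPolicy l = unifPolicy := by
  classical
  funext t
  rw [executedPolicy, ite_apply, ite_eq_left_iff]
  intro _
  cases h : l[(l.map Checkpoint.time).countP (· < t.1)]? with
  | none => rfl
  | some e => rw [Option.elim_some, hl e (List.mem_of_getElem? h)]

theorem actWeight_unifPolicy (p : ℕ) (s : S) (a : A) :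
    actWeight (unifPolicy : Policy S A H) p s a = (Fintype.card A : ℝ)⁻¹ := by
  unfold actWeight unifPolicy
  split_ifs <;> simp

end ScheduleQueries

section Cover

variable {S A R : Type*} {M H : ℕ}

/-- The states which can be reached at time index `p` in a context of the model `θ`, among the
contexts of `θ` and a second model. -/
def leftReach (θ : LMDP S A R M) (π : Policy S A H) (p : ℕ) : Fin M ⊕ Fin M → S → Prop
  | Sum.inl m, s => θ.Reach m π p s
  | Sum.inr _, _ => False

theorem leftReach_zero_of_initWeight_pos [Nonempty A] {θ θ' : LMDP S A R M} (π : Policy S A H)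
    {s : S} {j : Fin M ⊕ Fin M} (hj : 0 < initWeight θ θ' s j) : leftReach θ π 0 j s := by
  obtain m | m := j
  · have hs : (θ.T m none s).toReal ≠ 0 := right_ne_zero_of_mul hj.ne'
    obtain ⟨a⟩ := ‹Nonempty A›
    obtain ⟨r, _⟩ := (θ.rew m s a).support_nonempty
    exact ⟨fun _ => (s, a, r), fun t _ ht => absurd ht t.not_lt_zero,
      (ENNReal.toReal_ne_zero.1 hs).1⟩
  · refine absurd hj (not_lt.2 ?_)
    exact mul_nonpos_of_nonpos_of_nonneg (neg_nonpos.2 ENNReal.toReal_nonneg)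
      ENNReal.toReal_nonneg

variable [Fintype S]

theorem toReal_apply_le_min_two_card_mul {p q : PMF S} {s : S} (h : p s ≤ 2 * q s) :
    (p s).toReal ≤ min 2 (Fintype.card S : ℝ) * (q s).toReal := by
  rcases subsingleton_or_nontrivial S with _ | _
  · have hone (p : PMF S) : (p s).toReal = 1 := by
      simpa only [Fintype.sum_subsingleton _ s] using sum_toReal_pmf p
    rw [hone, hone, mul_one, le_min_iff]
    exact ⟨one_le_two, by exact_mod_cast Fintype.card_pos_iff.2 ⟨s⟩⟩
  · rw [min_eq_left (by exact_mod_cast Fintype.one_lt_card (α := S))]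
    simpa only [ENNReal.toReal_mul, ENNReal.toReal_ofNat] using
      ENNReal.toReal_mono (ENNReal.mul_ne_top ENNReal.ofNat_ne_top (q.apply_ne_top s)) h

variable [Fintype A] [Fintype R] {θ : LMDP S A R M} {Ψ : Finset (Policy S A H)}
  {π : Policy S A H}

theorem stateFrom_le_of_not_doublesCoverage (hπ : ¬ DoublesCoverage θ Ψ π) {m : Fin M} {p n : ℕ}
    (hpn : p + n < H) {s' : S} (h : θ.Reach m π p s') (s : S) :
    θ.stateFrom m π p s' n s ≤ 2 * Ψ.sup fun ψ => θ.stateFrom m ψ p s' n s := by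
  by_contra! hlt
  refine hπ ⟨m, ⟨p, by omega⟩, p + n + 1, s, s', by simp only; omega, hpn, h.visitProb_pos _, ?_⟩
  simpa only [LMDP.segProb, show p + n + 1 - (p + 1) = n by omega] using hlt

theorem exists_stateFrom_le_of_not_doublesCoverage (hΨ : Ψ.Nonempty)
    (hπ : ¬ DoublesCoverage θ Ψ π) :
    ∃ Cand : ℕ → ℕ → Finset (Policy S A H), (∀ p q, Cand p q ⊆ Ψ) ∧
      (∀ p q, (Cand p q).card ≤ M * Fintype.card S ^ 2) ∧
      ∀ {p n m s'} s, p + n < H → θ.Reach m π p s' → ∃ ψ ∈ Cand p (p + n),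
        θ.stateFrom m π p s' n s ≤ 2 * θ.stateFrom m ψ p s' n s := by
  classical
  have hmax (p q : ℕ) (z : Fin M × S × S) : ∃ ψ ∈ Ψ,
      Ψ.sup (fun ψ => θ.stateFrom z.1 ψ p z.2.1 (q - p) z.2.2) =
        θ.stateFrom z.1 ψ p z.2.1 (q - p) z.2.2 :=
    Finset.exists_mem_eq_sup Ψ hΨ _
  choose f hf hsup using hmax
  refine ⟨fun p q => Finset.univ.image (f p q), fun p q => ?_, fun p q => ?_, ?_⟩
  · exact Finset.image_subset_iff.2 fun z _ => hf p q z
  · refine Finset.card_image_le.trans_eq ?_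
    simp only [Finset.card_univ, Fintype.card_prod, Fintype.card_fin, sq]
  · intro p n m s' s hpn h
    refine ⟨f p (p + n) (m, s', s), Finset.mem_image_of_mem _ (Finset.mem_univ _), ?_⟩
    have hle := stateFrom_le_of_not_doublesCoverage hπ hpn h s
    have hs := hsup p (p + n) (m, s', s)
    rw [Nat.add_sub_cancel_left] at hs
    rwa [hs] at hle

theorem exists_isCover_of_not_doublesCoverage (hΨ : Ψ.Nonempty) (hπ : ¬ DoublesCoverage θ Ψ π) :
    ∃ Cand : ℕ → ℕ → Finset (Policy S A H), (∀ p q, Cand p q ⊆ Ψ) ∧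
      (∀ p q, (Cand p q).card ≤ M * Fintype.card S ^ 2) ∧
      ∀ θ', IsCover (pairWeight H θ θ') (actWeight π) actWeight (leftReach θ π) Cand
        (min 2 (Fintype.card S)) H := by
  obtain ⟨Cand, hsub, hcard, hle⟩ := exists_stateFrom_le_of_not_doublesCoverage hΨ hπ
  refine ⟨Cand, hsub, hcard, fun θ' => ⟨?_, ?_⟩⟩
  · rintro p n (m | m) s' s hpn h hpos
    exacts [LMDP.Reach.of_segWeight_pos θ' h hpn hpos, h]
  · rintro p n (m | m) s' s hpn h
    · obtain ⟨ψ, hψ, hψle⟩ := hle s hpn h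
      refine ⟨ψ, hψ, ?_⟩
      simp only [segWeight_eq_stateFrom θ θ' m _ p s' n s hpn]
      exact toReal_apply_le_min_two_card_mul hψle
    · exact h.elim

variable [Nonempty A]

theorem IsCover.tvDist_le {C : ℝ} {d : ℕ} {Cand : ℕ → ℕ → Finset (Policy S A H)}
    {θ θ' : LMDP S A R M}
    (h : IsCover (pairWeight H θ θ') (actWeight π) actWeight (leftReach θ π) Cand C H)
    (hH : 0 < H) (hd : 2 * M ≤ d + 1) (hC : 0 ≤ C) :
    tvDist (θ.law π) (θ'.law π) ≤
      ∑ l ∈ schedules Cand d H 0, scheduleWeight C (Fintype.card A) l *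
        tvDist (θ.law (executedPolicy l)) (θ'.law (executedPolicy l)) := by
  have hK : (0 : ℝ) < Fintype.card A := by exact_mod_cast Fintype.card_pos
  have hu := isActionLaw_actWeight (unifPolicy : Policy S A H)
  have hmass (s : S) := posMass_le_sum_scheduleTerm h (isStepLaw_outcomeWeight _ _ _)
    isActionLaw_actWeight hu actWeight_unifPolicy (isActionLaw_actWeight π) hC hK d H 0
    (initWeight θ θ' s) s (zero_add H) (fun j => leftReach_zero_of_initWeight_pos π)
    ((Set.ncard_le_card _).trans (by
      simp only [Nat.card_eq_fintype_card, Fintype.card_sum, Fintype.card_fin]; omega))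
  rw [← two_mul_sum_posMass_initWeight hH θ θ' π (e := 1) (Or.inl rfl)]
  simp only [one_smul]
  refine (mul_le_mul_of_nonneg_left (Finset.sum_le_sum fun s _ => hmass s) two_pos.le).trans_eq ?_
  rw [Finset.sum_comm, Finset.mul_sum]
  refine Finset.sum_congr rfl fun l hl => ?_
  rw [← two_mul_sum_posMass_initWeight hH θ θ' _ (scheduleSign_eq_one_or_neg_one l),
    mul_left_comm]
  simp only [scheduleTerm, ← Finset.mul_sum]
  congr! 3 with s
  exact posMass_congr _ _ _ _ fun q _ =>
    (actWeight_executedPolicy (sortedLT_of_mem_schedules hl) q).symm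

end Cover

section WeightSums

theorem sq_sum_mul_le_of_forall_eq {ι : Type*} (s : Finset ι) (w T : ι → ℝ) (P : ι → Prop)
    [DecidablePred P] {x : ℝ} (hT : ∀ i ∈ s, P i → T i = x) :
    (∑ i ∈ s, w i * T i) ^ 2 ≤
      ((∑ i ∈ s with P i, w i) ^ 2 + ∑ i ∈ s, w i ^ 2) * (x ^ 2 + ∑ i ∈ s with ¬ P i, T i ^ 2) := by
  have hsplit : ∑ i ∈ s, w i * T i =
      (∑ i ∈ s with P i, w i) * x + ∑ i ∈ s with ¬ P i, w i * T i := by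
    rw [← Finset.sum_filter_add_sum_filter_not s P, Finset.sum_mul]
    congr 1
    refine Finset.sum_congr rfl fun i hi => ?_
    rw [hT i (Finset.mem_filter.1 hi).1 (Finset.mem_filter.1 hi).2]
  have hcs := Finset.sum_mul_sq_le_sq_mul_sq (Finset.insertNone (s.filter fun i => ¬ P i))
    (fun i => i.elim (∑ i ∈ s with P i, w i) w) (fun i => i.elim x T)
  simp only [Finset.sum_insertNone, Option.elim_none, Option.elim_some, ← hsplit] at hcs
  have hfilter : ∑ i ∈ s with ¬ P i, w i ^ 2 ≤ ∑ i ∈ s, w i ^ 2 :=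
    Finset.sum_le_sum_of_subset_of_nonneg (Finset.filter_subset _ _) fun _ _ _ => sq_nonneg _
  exact hcs.trans (by gcongr)

variable {Q : Type*} {Cand : ℕ → ℕ → Finset Q} {C K : ℝ} {H : ℕ}

theorem sum_scheduleWeight_le_of_policy_eq (ψ₀ : Q)
    [DecidablePred fun l : List (Checkpoint Q) => ∀ e ∈ l, e.policy = ψ₀]
    (hC : 1 ≤ C) (hK : 0 ≤ K) (hH : 1 ≤ H) (n : ℕ) :
    ∑ l ∈ schedules Cand n H 0 with ∀ e ∈ l, e.policy = ψ₀, scheduleWeight C K l ≤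
      (H * (C * (K + 1))) ^ n := by
  classical
  have : 0 ≤ C := zero_le_one.trans hC
  let g (b : Bool) (ψ : Q) : ℝ := if ψ = ψ₀ then C * (if b = true then K else 1) else 0
  have hg (b : Bool) (ψ : Q) : 0 ≤ g b ψ := by
    simp only [g]
    split_ifs <;> positivity
  have hsum (b : Bool) (s : Finset Q) : ∑ ψ ∈ s, g b ψ ≤ C * if b = true then K else 1 := by
    rw [Finset.sum_ite_eq']
    split_ifs <;> first | exact le_rfl | positivity
  calc _ = ∑ l ∈ schedules Cand n H 0 with ∀ e ∈ l, e.policy = ψ₀,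
        (l.map fun e => g e.random e.policy).prod := by
        refine Finset.sum_congr rfl fun l hl =>
          congrArg List.prod (List.map_congr_left fun e he => ?_)
        exact (if_pos ((Finset.mem_filter.1 hl).2 e he)).symm
    _ ≤ ∑ l ∈ schedules Cand n H 0, (l.map fun e => g e.random e.policy).prod :=
        Finset.sum_le_sum_of_subset_of_nonneg (Finset.filter_subset _ _) fun l _ _ =>
          List.prod_nonneg fun x hx => by
            obtain ⟨e, _, rfl⟩ := List.mem_map.1 hx
            exact hg _ _
    _ ≤ (H * (C * (K + 1))) ^ n := by
        refine sum_schedules_prod_le Cand hg (fun p q q' => ?_) ?_ n H 0 le_rfl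
        · simpa only [if_true, Bool.false_eq_true, if_false, ← mul_add] using
            add_le_add (hsum true (Cand p q)) (hsum false (Cand p q'))
        · exact one_le_mul_of_one_le_of_one_le (by exact_mod_cast hH)
            (one_le_mul_of_one_le_of_one_le hC (by linarith))

theorem sum_scheduleWeight_sq_le {N : ℝ} (hCand : ∀ p q, ((Cand p q).card : ℝ) ≤ N) (hN : 1 ≤ N)
    (hC : 1 ≤ C) (hH : 1 ≤ H) (n : ℕ) :
    ∑ l ∈ schedules Cand n H 0, scheduleWeight C K l ^ 2 ≤
      (H * (N * (C ^ 2 * (K ^ 2 + 1)))) ^ n := by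
  have hweight (l : List (Checkpoint Q)) : scheduleWeight C K l ^ 2 =
      (l.map fun e => (C * if e.random = true then K else 1) ^ 2).prod :=
    (Multiset.prod_map_pow (m := (l : Multiset (Checkpoint Q)))).symm
  simp only [hweight]
  refine sum_schedules_prod_le Cand (g := fun b _ => (C * if b = true then K else 1) ^ 2)
    (fun b _ => sq_nonneg _) (fun p q q' => ?_) ?_ n H 0 le_rfl
  · simp only [Finset.sum_const, nsmul_eq_mul, if_true, Bool.false_eq_true, if_false]
    calc _ ≤ N * (C * K) ^ 2 + N * (C * 1) ^ 2 := by gcongr <;> exact hCand _ _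
      _ = N * (C ^ 2 * (K ^ 2 + 1)) := by ring
  · exact one_le_mul_of_one_le_of_one_le (by exact_mod_cast hH)
      (one_le_mul_of_one_le_of_one_le hN (one_le_mul_of_one_le_of_one_le (one_le_pow₀ hC)
        (le_add_of_nonneg_left (sq_nonneg K))))

theorem sq_pow_add_pow_le {H M S A C : ℝ} {d : ℕ} (hd : d ≠ 0) (hH : 2 ≤ H) (hM : 1 ≤ M)
    (hA : 1 ≤ A) (hC : 1 ≤ C) (hC₂ : C ≤ 2) (hCS : C ≤ S) :
    ((H * (C * (A + 1))) ^ d) ^ 2 + (H * (M * S ^ 2 * (C ^ 2 * (A ^ 2 + 1)))) ^ d ≤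
      (8 * H ^ 2) ^ d * (M * S ^ 2 * A ^ 2) ^ d := by
  have : 0 ≤ S := by linarith
  rw [pow_right_comm, ← mul_pow]
  refine (pow_add_pow_le (sq_nonneg _) (by positivity) hd).trans
    (pow_le_pow_left₀ (by positivity) ?_ d)
  have hA₁ : (A + 1) ^ 2 ≤ 4 * A ^ 2 := by nlinarith
  have hA₂ : A ^ 2 + 1 ≤ 2 * A ^ 2 := by nlinarith
  calc (H * (C * (A + 1))) ^ 2 + H * (M * S ^ 2 * (C ^ 2 * (A ^ 2 + 1)))
      = H ^ 2 * (1 * C ^ 2 * (A + 1) ^ 2) + H * (M * S ^ 2 * (C ^ 2 * (A ^ 2 + 1))) := by ring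
    _ ≤ H ^ 2 * (M * S ^ 2 * (4 * A ^ 2)) + H * (M * S ^ 2 * (2 ^ 2 * (2 * A ^ 2))) := by gcongr
    _ = H * (4 * H + 8) * (M * S ^ 2 * A ^ 2) := by ring
    _ ≤ H * (8 * H) * (M * S ^ 2 * A ^ 2) := by gcongr; linarith
    _ = 8 * H ^ 2 * (M * S ^ 2 * A ^ 2) := by ring

theorem sq_sum_add_sum_sq_scheduleWeight_le {M S A : ℝ} {d : ℕ} (ψ₀ : Q)
    [DecidablePred fun l : List (Checkpoint Q) => ∀ e ∈ l, e.policy = ψ₀]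
    (hCand : ∀ p q, ((Cand p q).card : ℝ) ≤ M * S ^ 2) (hd : d ≠ 0) (hH : 2 ≤ H) (hM : 1 ≤ M)
    (hA : 1 ≤ A) (hC : 1 ≤ C) (hC₂ : C ≤ 2) (hCS : C ≤ S) :
    (∑ l ∈ schedules Cand d H 0 with ∀ e ∈ l, e.policy = ψ₀, scheduleWeight C A l) ^ 2 +
        ∑ l ∈ schedules Cand d H 0, scheduleWeight C A l ^ 2 ≤
      (8 * (H : ℝ) ^ 2) ^ d * (M * S ^ 2 * A ^ 2) ^ d := by
  have hA₀ : 0 ≤ A := zero_le_one.trans hA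
  have hnonneg : 0 ≤ ∑ l ∈ schedules Cand d H 0 with ∀ e ∈ l, e.policy = ψ₀, scheduleWeight C A l :=
    Finset.sum_nonneg fun l _ => scheduleWeight_nonneg (zero_le_one.trans hC) hA₀ l
  have hlinear := sum_scheduleWeight_le_of_policy_eq (Cand := Cand) ψ₀ hC hA₀ (by omega : 1 ≤ H) d
  have hsquare := sum_scheduleWeight_sq_le (K := A) hCand
    (one_le_mul_of_one_le_of_one_le hM (one_le_pow₀ (hC.trans hCS))) hC (by omega : 1 ≤ H) d
  exact (add_le_add (pow_le_pow_left₀ hnonneg hlinear 2) hsquare).trans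
    (sq_pow_add_pow_le hd (by exact_mod_cast hH) hM hA hC hC₂ hCS)

end WeightSums

section Coverage

variable {S A R : Type*} [Fintype A] [Nonempty A] {M H d : ℕ}

/-- The policy which the algorithm executes for a query. -/
noncomputable def queryPolicy (q : (Fin d → Policy S A H) × Switching H d) : Policy S A H :=
  segmented (Fin.snoc q.1 unifPolicy) q.2

open Classical in
/-- The queries with policies in `Ψ`, not all of which are the uniform policy. These are the
queries which the algorithm has made once its test set is `Ψ`. -/
noncomputable def properQueries (d : ℕ) (Ψ : Finset (Policy S A H)) :
    Finset ((Fin d → Policy S A H) × Switching H d) :=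
  (Fintype.piFinset fun _ => Ψ).filter (fun ψ => ∃ i, ψ i ≠ unifPolicy) ×ˢ Finset.univ

theorem scheduleTuple_switching_mem_properQueries {Ψ : Finset (Policy S A H)}
    (hΨ : unifPolicy ∈ Ψ) {l : List (Checkpoint (Policy S A H))} (hl : IsSchedule H d l)
    (hlΨ : ∀ e ∈ l, e.policy ∈ Ψ) (hne : ¬ ∀ e ∈ l, e.policy = unifPolicy) :
    (scheduleTuple d l, hl.switching) ∈ properQueries d Ψ := by
  simp only [properQueries, Finset.mem_product, Finset.mem_filter, Fintype.mem_piFinset,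
    Finset.mem_univ, and_true, scheduleTuple]
  refine ⟨fun i => ?_, ?_⟩
  · cases hi : l[i.1]? with
    | none => exact hΨ
    | some e => exact hlΨ e (List.mem_of_getElem? hi)
  · push Not at hne
    obtain ⟨e, he, hne⟩ := hne
    obtain ⟨i, hi, rfl⟩ := List.getElem_of_mem he
    refine ⟨⟨i, hi.trans_le hl.length_le⟩, ?_⟩
    rwa [List.getElem?_eq_getElem hi]

theorem sum_executedPolicy_le_sum_properQueries {Cand : ℕ → ℕ → Finset (Policy S A H)}
    [DecidablePred fun l : List (Checkpoint (Policy S A H)) => ∀ e ∈ l, e.policy = unifPolicy]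
    {Ψ : Finset (Policy S A H)} (hΨ : unifPolicy ∈ Ψ) (hCand : ∀ p q, Cand p q ⊆ Ψ) (hH : H ≠ 0)
    (hd : d ≠ 0) {g : Policy S A H → ℝ} (hg : ∀ π, 0 ≤ g π) :
    ∑ l ∈ schedules Cand d H 0 with ¬ ∀ e ∈ l, e.policy = unifPolicy, g (executedPolicy l) ≤
      ∑ q ∈ properQueries d Ψ, g (queryPolicy q) := by
  set L := (schedules Cand d H 0).filter fun l => ¬ ∀ e ∈ l, e.policy = unifPolicy
  have hmem (l : L) : l.1 ∈ schedules Cand d H 0 := (Finset.mem_filter.1 l.2).1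
  have hl (l : L) : IsSchedule H d l.1 := isSchedule_of_mem_schedules hH hd (hmem l)
  let query (l : L) : (Fin d → Policy S A H) × Switching H d :=
    (scheduleTuple d l.1, (hl l).switching)
  have hinj : Function.Injective query := fun l l' h =>
    Subtype.ext ((hl l).eq_of_switching_eq (hl l') (congrArg Prod.fst h) (congrArg Prod.snd h))
  calc ∑ l ∈ L, g (executedPolicy l) = ∑ l : L, g (queryPolicy (query l)) := by
        rw [← Finset.sum_coe_sort]
        exact Finset.sum_congr rfl fun l _ =>
          congrArg g (hl l).segmented_eq_executedPolicy.symm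
    _ = ∑ q ∈ Finset.univ.map ⟨query, hinj⟩, g (queryPolicy q) := by
        rw [Finset.sum_map, Function.Embedding.coeFn_mk]
    _ ≤ ∑ q ∈ properQueries d Ψ, g (queryPolicy q) := by
        refine Finset.sum_le_sum_of_subset_of_nonneg ?_ fun _ _ _ => hg _
        intro q hq
        obtain ⟨l, _, rfl⟩ := Finset.mem_map.1 hq
        exact scheduleTuple_switching_mem_properQueries hΨ (hl l)
          (policy_mem_of_mem_schedules hCand (hmem l)) (Finset.mem_filter.1 l.2).2

theorem tvDist_nonneg {X : Type*} [Fintype X] (p q : PMF X) : 0 ≤ tvDist p q :=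
  Finset.sum_nonneg fun _ _ => abs_nonneg _

variable [Fintype S] [Fintype R]

theorem tvDist_sq_le_of_not_doublesCoverage (hH : 2 ≤ H) (hd : 2 * M ≤ d + 1) {θ : LMDP S A R M}
    (θ' : LMDP S A R M) {Ψ : Finset (Policy S A H)} (hΨ : unifPolicy ∈ Ψ) {π : Policy S A H}
    (hπ : ¬ DoublesCoverage θ Ψ π) :
    tvDist (θ.law π) (θ'.law π) ^ 2 ≤
      (8 * (H : ℝ) ^ 2) ^ d * (M * Fintype.card S ^ 2 * Fintype.card A ^ 2) ^ d *
        (tvDist (θ.law (unifPolicy : Policy S A H)) (θ'.law unifPolicy) ^ 2 +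
          ∑ q ∈ properQueries d Ψ,
            tvDist (θ.law (queryPolicy q)) (θ'.law (queryPolicy q)) ^ 2) := by
  classical
  obtain ⟨Cand, hsub, hcard, hcover⟩ := exists_isCover_of_not_doublesCoverage ⟨_, hΨ⟩ hπ
  obtain ⟨m, _⟩ := θ.w.support_nonempty
  obtain ⟨s, _⟩ := (θ.T m none).support_nonempty
  have hS : (1 : ℝ) ≤ Fintype.card S := by exact_mod_cast Fintype.card_pos_iff.2 ⟨s⟩
  have hC : 1 ≤ min 2 (Fintype.card S : ℝ) := le_min one_le_two hS
  have hd₀ : d ≠ 0 := by have := m.pos; omega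
  have hweight := sq_sum_add_sum_sq_scheduleWeight_le (H := H) (M := M) (A := Fintype.card A)
    unifPolicy (fun p q => by exact_mod_cast hcard p q) hd₀ hH (by exact_mod_cast m.pos)
    (by exact_mod_cast Fintype.card_pos) hC (min_le_left _ _) (min_le_right _ _)
  have hproper := sum_executedPolicy_le_sum_properQueries hΨ hsub (by omega : H ≠ 0) hd₀
    (g := fun π => tvDist (θ.law π) (θ'.law π) ^ 2) fun _ => sq_nonneg _
  have hcs := sq_sum_mul_le_of_forall_eq (schedules Cand d H 0)
    (scheduleWeight (min 2 (Fintype.card S : ℝ)) (Fintype.card A))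
    (fun l => tvDist (θ.law (executedPolicy l)) (θ'.law (executedPolicy l)))
    (fun l => ∀ e ∈ l, e.policy = unifPolicy) (x := tvDist (θ.law unifPolicy) (θ'.law unifPolicy))
    fun l _ hl => by rw [executedPolicy_eq_unifPolicy hl]
  have hsum := (pow_le_pow_left₀ (tvDist_nonneg _ _)
    ((hcover θ').tvDist_le (by omega) hd (zero_le_one.trans hC)) 2).trans hcs
  exact hsum.trans (mul_le_mul hweight (add_le_add_right hproper _)
    (add_nonneg (sq_nonneg _) (Finset.sum_nonneg fun _ _ => sq_nonneg _)) (by positivity))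

end Coverage

/-! ### Likelihood ratios -/

section Mean

variable {α γ : Type*}

/-- The mean of a nonnegative function under a discrete law. -/
noncomputable def pmfMean (p : PMF α) (f : α → ℝ≥0∞) : ℝ≥0∞ := ∑' x, p x * f x

theorem pmfMean_mono {p : PMF α} {f g : α → ℝ≥0∞} (h : ∀ x ∈ p.support, f x ≤ g x) :
    pmfMean p f ≤ pmfMean p g := by
  refine ENNReal.tsum_le_tsum fun x => ?_
  rcases eq_or_ne (p x) 0 with hx | hx
  · simp only [hx, zero_mul, le_refl]
  · exact mul_le_mul_right (h x ((p.mem_support_iff x).2 hx)) _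

theorem pmfMean_const (p : PMF α) (b : ℝ≥0∞) : pmfMean p (fun _ => b) = b := by
  rw [pmfMean, ENNReal.tsum_mul_right, p.tsum_coe, one_mul]

theorem pmfMean_le {p : PMF α} {f : α → ℝ≥0∞} {b : ℝ≥0∞} (h : ∀ x ∈ p.support, f x ≤ b) :
    pmfMean p f ≤ b :=
  (pmfMean_mono h).trans_eq (pmfMean_const p b)

theorem pmfMean_mul_left (p : PMF α) (b : ℝ≥0∞) (f : α → ℝ≥0∞) :
    pmfMean p (fun x => b * f x) = b * pmfMean p f := by
  simp only [pmfMean, ← ENNReal.tsum_mul_left, mul_left_comm]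

theorem pmfMean_sum {ι : Type*} (p : PMF α) (s : Finset ι) (f : ι → α → ℝ≥0∞) :
    pmfMean p (fun x => ∑ i ∈ s, f i x) = ∑ i ∈ s, pmfMean p (f i) := by
  simp only [pmfMean, Finset.mul_sum]
  exact Summable.tsum_finsetSum fun _ _ => ENNReal.summable

theorem pmfMean_pure (x : α) (f : α → ℝ≥0∞) : pmfMean (PMF.pure x) f = f x := by
  rw [pmfMean, tsum_eq_single x fun y hy => by rw [PMF.pure_apply_of_ne _ _ hy, zero_mul],
    PMF.pure_apply_self, one_mul]

theorem pmfMean_bind (p : PMF α) (g : α → PMF γ) (f : γ → ℝ≥0∞) :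
    pmfMean (p.bind g) f = pmfMean p fun x => pmfMean (g x) f := by
  simp only [pmfMean, PMF.bind_apply, ← ENNReal.tsum_mul_right, ← ENNReal.tsum_mul_left]
  rw [ENNReal.tsum_comm]
  simp only [mul_assoc]

theorem pmfMean_map (p : PMF α) (g : α → γ) (f : γ → ℝ≥0∞) :
    pmfMean (p.map g) f = pmfMean p fun x => f (g x) := by
  simp only [PMF.map, pmfMean_bind, Function.comp_apply, pmfMean_pure]

theorem one_le_toOuterMeasure_add_pmfMean (p : PMF α) (s : Set α) {f : α → ℝ≥0∞}
    (h : ∀ x ∉ s, 1 ≤ f x) : 1 ≤ p.toOuterMeasure s + pmfMean p f := by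
  classical
  rw [PMF.toOuterMeasure_apply, pmfMean, ← ENNReal.tsum_add, ← p.tsum_coe]
  refine ENNReal.tsum_le_tsum fun x => ?_
  by_cases hx : x ∈ s
  · rw [Set.indicator_of_mem hx]
    exact le_self_add
  · rw [Set.indicator_of_notMem hx, zero_add]
    exact le_mul_of_one_le_right' (h x hx)

end Mean

section Likelihood

variable {X : Type*} [Fintype X]

/-- The Bhattacharyya coefficient, a measure of the overlap of two laws. -/
noncomputable def affinity (p q : PMF X) : ℝ := ∑ x, √(p x).toReal * √(q x).toReal

theorem affinity_nonneg (p q : PMF X) : 0 ≤ affinity p q :=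
  Finset.sum_nonneg fun _ _ => mul_nonneg (Real.sqrt_nonneg _) (Real.sqrt_nonneg _)

theorem affinity_pos {p q : PMF X} {x : X} (hp : p x ≠ 0) (hq : q x ≠ 0) : 0 < affinity p q :=
  Finset.sum_pos' (fun _ _ => mul_nonneg (Real.sqrt_nonneg _) (Real.sqrt_nonneg _))
    ⟨x, Finset.mem_univ x, mul_pos (Real.sqrt_pos.2 (ENNReal.toReal_pos hp (p.apply_ne_top x)))
      (Real.sqrt_pos.2 (ENNReal.toReal_pos hq (q.apply_ne_top x)))⟩

theorem sum_sqrt_add_mul_sqrt_sq (p q : PMF X) {e : ℝ} (he : e ^ 2 = 1) :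
    ∑ x, (√(p x).toReal + e * √(q x).toReal) ^ 2 = 2 + 2 * e * affinity p q := by
  have hexpand (x : X) : (√(p x).toReal + e * √(q x).toReal) ^ 2 =
      (p x).toReal + (q x).toReal + 2 * e * (√(p x).toReal * √(q x).toReal) := by
    rw [add_sq, mul_pow, he, Real.sq_sqrt ENNReal.toReal_nonneg, Real.sq_sqrt ENNReal.toReal_nonneg]
    ring
  simp only [hexpand, Finset.sum_add_distrib, ← Finset.mul_sum, sum_toReal_pmf, affinity,
    one_add_one_eq_two]

theorem tvDist_sq_le_affinity (p q : PMF X) : tvDist p q ^ 2 ≤ 8 * (1 - affinity p q) := by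
  have hfactor (x : X) : |(p x).toReal - (q x).toReal| =
      |√(p x).toReal + -1 * √(q x).toReal| * |√(p x).toReal + 1 * √(q x).toReal| := by
    nth_rw 1 [← Real.sq_sqrt (ENNReal.toReal_nonneg (a := p x)),
      ← Real.sq_sqrt (ENNReal.toReal_nonneg (a := q x))]
    rw [← abs_mul]
    ring_nf
  calc tvDist p q ^ 2 ≤ (2 + 2 * -1 * affinity p q) * (2 + 2 * 1 * affinity p q) := by
        rw [← sum_sqrt_add_mul_sqrt_sq p q (by norm_num : (-1 : ℝ) ^ 2 = 1),
          ← sum_sqrt_add_mul_sqrt_sq p q (one_pow 2)]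
        simp only [tvDist, hfactor, ← sq_abs (_ + _)]
        exact Finset.sum_mul_sq_le_sq_mul_sq _ _ _
    _ ≤ 8 * (1 - affinity p q) := by nlinarith only [sq_nonneg (1 - affinity p q)]

/-- The square root of the likelihood ratio of `q` to `p`, normalized so as to have mean at most one
under `p`. -/
noncomputable def sqrtRatio (p q : PMF X) (x : X) : ℝ :=
  √(q x).toReal / √(p x).toReal / affinity p q

theorem sqrtRatio_nonneg (p q : PMF X) (x : X) : 0 ≤ sqrtRatio p q x :=
  div_nonneg (div_nonneg (Real.sqrt_nonneg _) (Real.sqrt_nonneg _)) (affinity_nonneg p q)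

theorem sqrtRatio_pos {p q : PMF X} {x : X} (hp : p x ≠ 0) (hq : q x ≠ 0) : 0 < sqrtRatio p q x :=
  div_pos (div_pos (Real.sqrt_pos.2 (ENNReal.toReal_pos hq (q.apply_ne_top x)))
    (Real.sqrt_pos.2 (ENNReal.toReal_pos hp (p.apply_ne_top x)))) (affinity_pos hp hq)

theorem toReal_mul_sqrtRatio (p q : PMF X) (x : X) :
    (p x).toReal * sqrtRatio p q x = √(p x).toReal * √(q x).toReal / affinity p q := by
  rw [sqrtRatio, mul_div, mul_div_left_comm, Real.div_sqrt, mul_comm √(q x).toReal]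

theorem pmfMean_sqrtRatio_le (p q : PMF X) :
    pmfMean p (fun x => ENNReal.ofReal (sqrtRatio p q x)) ≤ 1 := by
  calc pmfMean p (fun x => ENNReal.ofReal (sqrtRatio p q x))
      = ∑ x, ENNReal.ofReal ((p x).toReal * sqrtRatio p q x) := by
        simp only [pmfMean, tsum_fintype, ENNReal.ofReal_mul ENNReal.toReal_nonneg,
          ENNReal.ofReal_toReal (p.apply_ne_top _)]
    _ = ENNReal.ofReal (affinity p q / affinity p q) := by
        rw [← ENNReal.ofReal_sum_of_nonneg fun x _ =>
          mul_nonneg ENNReal.toReal_nonneg (sqrtRatio_nonneg p q x)]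
        simp only [toReal_mul_sqrtRatio, ← Finset.sum_div]
        rfl
    _ ≤ 1 := ENNReal.ofReal_le_one.2 (div_self_le_one _)

theorem tvDist_sq_le_log {p q : PMF X} {x : X} (hp : p x ≠ 0) (hq : q x ≠ 0) :
    tvDist p q ^ 2 ≤ 8 * (Real.log (sqrtRatio p q x) -
      (Real.log (q x).toReal - Real.log (p x).toReal) / 2) := by
  have hp₀ := ENNReal.toReal_pos hp (p.apply_ne_top x)
  have hq₀ := ENNReal.toReal_pos hq (q.apply_ne_top x)
  have hlog := Real.log_le_sub_one_of_pos (affinity_pos hp hq)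
  rw [sqrtRatio, Real.log_div (by positivity) (affinity_pos hp hq).ne',
    Real.log_div (by positivity) (by positivity), Real.log_sqrt hq₀.le, Real.log_sqrt hp₀.le]
  linarith only [hlog, tvDist_sq_le_affinity p q]

end Likelihood

section Data

variable {S A R : Type*} [Fintype S] [Fintype A] [Fintype R] {M H : ℕ}

/-- The likelihood of a dataset, given the executed policies. -/
noncomputable def LMDP.likelihood (θ : LMDP S A R M) (D : Dataset S A R H) : ℝ≥0∞ :=
  (D.map fun p => θ.law p.1 p.2).prod

theorem LMDP.likelihood_cons (θ : LMDP S A R M) (p : Policy S A H × Trajectory S A R H)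
    (D : Dataset S A R H) : θ.likelihood (p :: D) = θ.law p.1 p.2 * θ.likelihood D := rfl

theorem LMDP.likelihood_append (θ : LMDP S A R M) (D D' : Dataset S A R H) :
    θ.likelihood (D ++ D') = θ.likelihood D * θ.likelihood D' := by
  simp only [LMDP.likelihood, List.map_append, List.prod_append]

theorem LMDP.likelihood_ne_top (θ : LMDP S A R M) (D : Dataset S A R H) : θ.likelihood D ≠ ⊤ := by
  induction D with
  | nil => exact ENNReal.one_ne_top
  | cons p D ih => exact ENNReal.mul_ne_top ((θ.law p.1).apply_ne_top p.2) ih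

theorem LMDP.logLik_eq_log_likelihood (θ : LMDP S A R M) (D : Dataset S A R H) :
    θ.logLik D = ENNReal.log (θ.likelihood D) := by
  induction D with
  | nil => exact ENNReal.log_one.symm
  | cons p D ih =>
    rw [LMDP.likelihood_cons, ENNReal.log_mul_add, ← ih]
    rfl

/-- The product of the normalized square roots of the likelihood ratios of the episodes of a
dataset. -/
noncomputable def dataRatio (θs θ : LMDP S A R M) (D : Dataset S A R H) : ℝ :=
  (D.map fun p => sqrtRatio (θs.law p.1) (θ.law p.1) p.2).prod

theorem dataRatio_cons (θs θ : LMDP S A R M) (p : Policy S A H × Trajectory S A R H)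
    (D : Dataset S A R H) : dataRatio θs θ (p :: D) =
      sqrtRatio (θs.law p.1) (θ.law p.1) p.2 * dataRatio θs θ D := rfl

theorem dataRatio_append (θs θ : LMDP S A R M) (D D' : Dataset S A R H) :
    dataRatio θs θ (D ++ D') = dataRatio θs θ D * dataRatio θs θ D' := by
  simp only [dataRatio, List.map_append, List.prod_append]

theorem dataRatio_nonneg (θs θ : LMDP S A R M) (D : Dataset S A R H) : 0 ≤ dataRatio θs θ D :=
  List.prod_nonneg <| List.forall_mem_map.2 fun _ _ => sqrtRatio_nonneg _ _ _

theorem dataRatio_pos {θs θ : LMDP S A R M} {D : Dataset S A R H} (hs : θs.likelihood D ≠ 0)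
    (h : θ.likelihood D ≠ 0) : 0 < dataRatio θs θ D := by
  induction D with
  | nil => exact one_pos
  | cons p D ih =>
    exact mul_pos (sqrtRatio_pos (left_ne_zero_of_mul hs) (left_ne_zero_of_mul h))
      (ih (right_ne_zero_of_mul hs) (right_ne_zero_of_mul h))

theorem pmfMean_dataRatio_le (θs θ : LMDP S A R M) (l : List (Policy S A H)) :
    pmfMean (execute θs l) (fun D => ENNReal.ofReal (dataRatio θs θ D)) ≤ 1 := by
  induction l with
  | nil => rw [execute, pmfMean_pure, dataRatio, List.map_nil, List.prod_nil, ENNReal.ofReal_one]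
  | cons π l ih =>
    simp only [execute, pmfMean_bind, pmfMean_map, dataRatio_cons,
      ENNReal.ofReal_mul (sqrtRatio_nonneg _ _ _), pmfMean_mul_left]
    exact (pmfMean_mono fun _ _ => mul_le_of_le_one_right' ih).trans (pmfMean_sqrtRatio_le _ _)

theorem policies_eq_and_likelihood_ne_zero_of_mem_support_execute {θs : LMDP S A R M}
    {l : List (Policy S A H)} {D : Dataset S A R H} (hD : D ∈ (execute θs l).support) :
    D.map Prod.fst = l ∧ θs.likelihood D ≠ 0 := by
  induction l generalizing D with
  | nil =>
    rw [execute, PMF.mem_support_pure_iff] at hD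
    exact hD ▸ ⟨rfl, one_ne_zero⟩
  | cons π l ih =>
    simp only [execute, PMF.mem_support_bind_iff, PMF.mem_support_map_iff] at hD
    obtain ⟨x, hx, D, hD, rfl⟩ := hD
    exact ⟨congrArg (π :: ·) (ih hD).1, mul_ne_zero ((PMF.mem_support_iff _ _).1 hx) (ih hD).2⟩

theorem sum_tvDist_sq_le_log {θs θ : LMDP S A R M} {D : Dataset S A R H}
    (hs : θs.likelihood D ≠ 0) (h : θ.likelihood D ≠ 0) :
    (D.map fun p => tvDist (θs.law p.1) (θ.law p.1) ^ 2).sum ≤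
      8 * (Real.log (dataRatio θs θ D) -
        (Real.log (θ.likelihood D).toReal - Real.log (θs.likelihood D).toReal) / 2) := by
  induction D with
  | nil =>
    simp only [LMDP.likelihood, dataRatio, List.map_nil, List.sum_nil, List.prod_nil,
      ENNReal.toReal_one, Real.log_one, sub_self, zero_div, mul_zero, le_refl]
  | cons p D ih =>
    rw [LMDP.likelihood_cons] at hs h
    obtain ⟨hps, hs⟩ := ne_zero_and_ne_zero_of_mul hs
    obtain ⟨hp, h⟩ := ne_zero_and_ne_zero_of_mul h
    have hlog {x y : ℝ≥0∞} (hx : x ≠ 0) (hy : y ≠ 0) (hx' : x ≠ ⊤) (hy' : y ≠ ⊤) :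
        Real.log (x * y).toReal = Real.log x.toReal + Real.log y.toReal := by
      rw [ENNReal.toReal_mul, Real.log_mul (ENNReal.toReal_ne_zero.2 ⟨hx, hx'⟩)
        (ENNReal.toReal_ne_zero.2 ⟨hy, hy'⟩)]
    rw [List.map_cons, List.sum_cons, dataRatio_cons, LMDP.likelihood_cons, LMDP.likelihood_cons,
      hlog hps hs (PMF.apply_ne_top _ _) (θs.likelihood_ne_top D),
      hlog hp h (PMF.apply_ne_top _ _) (θ.likelihood_ne_top D),
      Real.log_mul (sqrtRatio_pos hps hp).ne' (dataRatio_pos hs h).ne']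
    linarith only [ih hs h, tvDist_sq_le_log hps hp]

theorem likelihood_ne_zero_and_log_le_of_mem_confSet {Θ : Finset (LMDP S A R M)}
    {θs θ : LMDP S A R M} (hθs : θs ∈ Θ) {β : ℝ} {D : Dataset S A R H}
    (hD : θs.likelihood D ≠ 0) (hθ : θ ∈ confSet Θ β D) :
    θ.likelihood D ≠ 0 ∧
      Real.log (θs.likelihood D).toReal - β ≤ Real.log (θ.likelihood D).toReal := by
  have hlik : θs.logLik D - (β : EReal) ≤ θ.logLik D :=
    (EReal.sub_le_sub (Finset.le_sup (f := fun θ' => θ'.logLik D) hθs) le_rfl).trans hθ.2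
  rw [LMDP.logLik_eq_log_likelihood, LMDP.logLik_eq_log_likelihood,
    ENNReal.log_pos_real hD (θs.likelihood_ne_top D), ← EReal.coe_sub] at hlik
  have hne : θ.likelihood D ≠ 0 :=
    ENNReal.log_eq_bot_iff.not.1 (ne_bot_of_le_ne_bot (EReal.coe_ne_bot _) hlik)
  rw [ENNReal.log_pos_real hne (θ.likelihood_ne_top D), EReal.coe_le_coe_iff] at hlik
  exact ⟨hne, hlik⟩

theorem sum_tvDist_sq_lt_of_mem_confSet {Θ : Finset (LMDP S A R M)} {θs θ : LMDP S A R M}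
    (hθs : θs ∈ Θ) {β : ℝ} {D : Dataset S A R H} (hD : θs.likelihood D ≠ 0)
    (hθ : θ ∈ confSet Θ β D) (hr : dataRatio θs θ D < Real.exp β) :
    (D.map fun p => tvDist (θs.law p.1) (θ.law p.1) ^ 2).sum < 12 * β := by
  obtain ⟨hne, hlik⟩ := likelihood_ne_zero_and_log_le_of_mem_confSet hθs hD hθ
  have hratio := (Real.log_lt_iff_lt_exp (dataRatio_pos hD hne)).2 hr
  linarith only [hlik, hratio, sum_tvDist_sq_le_log hD hne]

end Data

/-! ### Runs of the algorithm -/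

section Recorded

variable {S A R : Type*} [Fintype S] [Fintype A] [Fintype R] {M H d n : ℕ}

theorem tvDist_triangle {X : Type*} [Fintype X] (p q r : PMF X) :
    tvDist p r ≤ tvDist p q + tvDist q r := by
  simp only [tvDist, ← Finset.sum_add_distrib]
  exact Finset.sum_le_sum fun x _ => abs_sub_le _ _ _

theorem exists_mem_confSet_lt_tvDist {Θ : Finset (LMDP S A R M)} {β ε : ℝ} {σ : RunState S A R H}
    {π : Policy S A H} (hπ : IsDistinguishing Θ β ε σ π) (θs : LMDP S A R M) :
    ∃ θ ∈ confSet Θ β σ.data, 2 * ε < tvDist (θs.law π) (θ.law π) := by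
  obtain ⟨θ₁, h₁, θ₂, h₂, hlt⟩ := hπ
  have htri := tvDist_triangle (θ₁.law π) (θs.law π) (θ₂.law π)
  rw [tvDist_comm (θ₁.law π) (θs.law π)] at htri
  by_contra! hclose
  linarith only [hlt, htri, hclose θ₁ h₁, hclose θ₂ h₂]

variable [Nonempty A]

/-- The dataset `D` has positive likelihood under `θs`, and contains `n` episodes of the uniform
policy and of the policy of every proper query for `Ψ`. The containment is expressed by the sums of
nonnegative functions of the executed policies. -/
structure IsRecorded (θs : LMDP S A R M) (d n : ℕ) (Ψ : Finset (Policy S A H))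
    (D : Dataset S A R H) : Prop where
  likelihood_ne_zero : θs.likelihood D ≠ 0
  le_sum : ∀ g : Policy S A H → ℝ, (∀ π, 0 ≤ g π) →
    n * (g unifPolicy + ∑ q ∈ properQueries d Ψ, g (queryPolicy q)) ≤ (D.map fun p => g p.1).sum

theorem properQueries_testSet_nil : properQueries d (testSet ([] : List (Policy S A H))) = ∅ := by
  refine Finset.eq_empty_of_forall_notMem fun q hq => ?_
  simp only [properQueries, testSet, List.toFinset_nil, insert_empty_eq, Finset.mem_product,
    Finset.mem_filter, Fintype.mem_piFinset, Finset.mem_singleton] at hq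
  obtain ⟨⟨hunif, i, hi⟩, -⟩ := hq
  exact hi (hunif i)

open Classical in
theorem properQueries_testSet_append_subset (l : List (Policy S A H)) (π : Policy S A H) :
    properQueries d (testSet (l ++ [π])) ⊆
      properQueries d (testSet l) ∪ queries d (testSet (l ++ [π])) π := by
  intro q hq
  simp only [properQueries, queries, Finset.mem_union, Finset.mem_product, Finset.mem_filter,
    Fintype.mem_piFinset, Finset.mem_univ, and_true] at hq ⊢
  by_cases h : ∃ i, q.1 i = π
  · exact Or.inr ⟨hq.1, h⟩
  · refine Or.inl ⟨fun i => ?_, hq.2⟩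
    have hmem := hq.1 i
    simp only [testSet, Finset.mem_insert, List.mem_toFinset, List.mem_append,
      List.mem_singleton, not_exists.1 h i, or_false] at hmem ⊢
    exact hmem

theorem sum_map_plan (g : Policy S A H → ℝ) (Ψ : Finset (Policy S A H)) (π : Policy S A H) :
    ((plan d n Ψ π).map g).sum = n * ∑ q ∈ queries d Ψ π, g (queryPolicy q) := by
  rw [← Finset.sum_map_toList, ← List.sum_map_mul_left, plan, List.map_flatMap, List.flatMap,
    List.sum_flatten, List.map_map]
  refine congrArg List.sum (List.map_congr_left fun q _ => ?_)
  rw [Function.comp_apply, List.map_replicate, List.sum_replicate, nsmul_eq_mul, queryPolicy]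

theorem isRecorded_of_mem_support_execute_replicate {θs : LMDP S A R M} {D : Dataset S A R H}
    (hD : D ∈ (execute θs (List.replicate n unifPolicy)).support) :
    IsRecorded θs d n (testSet []) D := by
  obtain ⟨hpolicies, hlik⟩ := policies_eq_and_likelihood_ne_zero_of_mem_support_execute hD
  refine ⟨hlik, fun g _ => ?_⟩
  rw [properQueries_testSet_nil, Finset.sum_empty, add_zero, ← Function.comp_def g, ← List.map_map,
    hpolicies, List.map_replicate, List.sum_replicate, nsmul_eq_mul]

theorem IsRecorded.append {θs : LMDP S A R M} {l : List (Policy S A H)} {D D' : Dataset S A R H}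
    (hD : IsRecorded θs d n (testSet l) D) {π : Policy S A H}
    (hD' : D' ∈ (execute θs (plan d n (testSet (l ++ [π])) π)).support) :
    IsRecorded θs d n (testSet (l ++ [π])) (D ++ D') := by
  classical
  obtain ⟨hpolicies, hlik⟩ := policies_eq_and_likelihood_ne_zero_of_mem_support_execute hD'
  refine ⟨θs.likelihood_append D D' ▸ mul_ne_zero hD.likelihood_ne_zero hlik, fun g hg => ?_⟩
  have hsubset := calc
    ∑ q ∈ properQueries d (testSet (l ++ [π])), g (queryPolicy q)
      ≤ ∑ q ∈ properQueries d (testSet l) ∪ queries d (testSet (l ++ [π])) π, g (queryPolicy q) :=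
        Finset.sum_le_sum_of_subset_of_nonneg (properQueries_testSet_append_subset l π)
          fun _ _ _ => hg _
    _ ≤ ∑ q ∈ properQueries d (testSet l), g (queryPolicy q) +
          ∑ q ∈ queries d (testSet (l ++ [π])) π, g (queryPolicy q) := by
        rw [← Finset.sum_union_inter]
        exact le_add_of_nonneg_right (Finset.sum_nonneg fun _ _ => hg _)
  calc n * (g unifPolicy + ∑ q ∈ properQueries d (testSet (l ++ [π])), g (queryPolicy q))
      ≤ n * (g unifPolicy + ∑ q ∈ properQueries d (testSet l), g (queryPolicy q)) +
          n * ∑ q ∈ queries d (testSet (l ++ [π])) π, g (queryPolicy q) := by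
        rw [← mul_add, add_assoc]
        gcongr
    _ ≤ (D.map fun p => g p.1).sum + ((D'.map Prod.fst).map g).sum := by
        rw [hpolicies, sum_map_plan]
        exact add_le_add_left (hD.le_sum g hg) _
    _ = ((D ++ D').map fun p => g p.1).sum := by
        rw [List.map_append, List.sum_append, List.map_map, Function.comp_def]

theorem IsRecorded.doublesCoverage_of_isDistinguishing {Θ : Finset (LMDP S A R M)}
    {θs : LMDP S A R M} (hH : 2 ≤ H) (hd : 2 * M ≤ d + 1) (hθs : θs ∈ Θ) {ε β : ℝ} (hε : 0 < ε)
    (hn : 3 * β * (8 * H ^ 2) ^ d * (M * Fintype.card S ^ 2 * Fintype.card A ^ 2) ^ d / ε ^ 2 ≤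
      (n : ℝ))
    {σ : RunState S A R H} (hσ : IsRecorded θs d n (testSet σ.chosen) σ.data)
    (hr : ∀ θ ∈ Θ, dataRatio θs θ σ.data < Real.exp β) {π : Policy S A H}
    (hπ : IsDistinguishing Θ β ε σ π) : DoublesCoverage θs (testSet σ.chosen) π := by
  obtain ⟨θ, hθ, hfar⟩ := exists_mem_confSet_lt_tvDist hπ θs
  have hunif : unifPolicy ∈ testSet σ.chosen := Finset.mem_insert_self _ _
  by_contra hdouble
  have htransfer := tvDist_sq_le_of_not_doublesCoverage hH hd θ hunif hdouble
  have hrecorded := hσ.le_sum (fun π => tvDist (θs.law π) (θ.law π) ^ 2) fun _ => sq_nonneg _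
  have hfit := sum_tvDist_sq_lt_of_mem_confSet hθs hσ.likelihood_ne_zero hθ (hr θ hθ.1)
  set B : ℝ := (8 * (H : ℝ) ^ 2) ^ d * (M * Fintype.card S ^ 2 * Fintype.card A ^ 2) ^ d
  set Y : ℝ := _ + ∑ q ∈ properQueries d (testSet σ.chosen), _
  have hY : 0 ≤ Y := add_nonneg (sq_nonneg _) (Finset.sum_nonneg fun _ _ => sq_nonneg _)
  have hsq : (2 * ε) ^ 2 ≤ tvDist (θs.law π) (θ.law π) ^ 2 :=
    pow_le_pow_left₀ (by positivity) hfar.le 2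
  have hB : 0 < B := pos_of_mul_pos_left ((show 0 < (2 * ε) ^ 2 by positivity).trans_le
    (hsq.trans htransfer)) hY
  have hsamples : 3 * β * B ≤ n * ε ^ 2 := by
    rwa [mul_assoc (3 * β), div_le_iff₀ (by positivity)] at hn
  refine lt_irrefl ((n : ℝ) * (2 * ε) ^ 2) ?_
  calc (n : ℝ) * (2 * ε) ^ 2 ≤ n * (B * Y) := by gcongr; exact hsq.trans htransfer
    _ = B * (n * Y) := mul_left_comm _ _ _
    _ < B * (12 * β) := mul_lt_mul_of_pos_left (hrecorded.trans_lt hfit) hB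
    _ = 4 * (3 * β * B) := by ring
    _ ≤ 4 * (n * ε ^ 2) := by gcongr
    _ = n * (2 * ε) ^ 2 := by ring

end Recorded

section Run

variable {S A R : Type*} [Fintype S] [Fintype A] [Fintype R] {M H d n : ℕ}
  {Θ : Finset (LMDP S A R M)} {θs : LMDP S A R M} {β ε : ℝ}

/-- The sum over the class of the normalized square roots of the likelihood ratios, scaled so that
it is small as long as no model fits the data much better than expected. -/
noncomputable def scaledRatioSum (Θ : Finset (LMDP S A R M)) (θs : LMDP S A R M) (β : ℝ)
    (D : Dataset S A R H) : ℝ≥0∞ :=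
  ENNReal.ofReal (Real.exp (-β)) * ∑ θ ∈ Θ, ENNReal.ofReal (dataRatio θs θ D)

theorem scaledRatioSum_nil :
    scaledRatioSum Θ θs β ([] : Dataset S A R H) = ENNReal.ofReal (Θ.card * Real.exp (-β)) := by
  simp only [scaledRatioSum, dataRatio, List.map_nil, List.prod_nil, ENNReal.ofReal_one,
    Finset.sum_const, nsmul_eq_mul, mul_one]
  rw [ENNReal.ofReal_mul (Nat.cast_nonneg _), ENNReal.ofReal_natCast, mul_comm]

theorem dataRatio_lt_exp_of_scaledRatioSum_lt_one {D : Dataset S A R H}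
    (h : scaledRatioSum Θ θs β D < 1) {θ : LMDP S A R M} (hθ : θ ∈ Θ) :
    dataRatio θs θ D < Real.exp β := by
  have hterm : ENNReal.ofReal (Real.exp (-β) * dataRatio θs θ D) < 1 := by
    rw [ENNReal.ofReal_mul (Real.exp_nonneg _)]
    refine lt_of_le_of_lt (mul_le_mul_right ?_ _) h
    exact Finset.single_le_sum (f := fun θ => ENNReal.ofReal (dataRatio θs θ D))
      (fun _ _ => zero_le) hθ
  rwa [ENNReal.ofReal_lt_one, Real.exp_neg, inv_mul_lt_one₀ (Real.exp_pos β)] at hterm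

theorem pmfMean_scaledRatioSum_append_le (D : Dataset S A R H) (l : List (Policy S A H)) :
    pmfMean (execute θs l) (fun D' => scaledRatioSum Θ θs β (D ++ D')) ≤
      scaledRatioSum Θ θs β D := by
  simp only [scaledRatioSum, dataRatio_append, ENNReal.ofReal_mul (dataRatio_nonneg _ _ _),
    pmfMean_mul_left, pmfMean_sum]
  gcongr with θ
  exact mul_le_of_le_one_right' (pmfMean_dataRatio_le θs θ l)

variable [Nonempty A]

/-- Every policy chosen so far doubled the coverage of the test policies of its iteration. -/
def AllDouble (θs : LMDP S A R M) (σ : RunState S A R H) : Prop :=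
  ∀ (k : ℕ) (hk : k < σ.chosen.length),
    DoublesCoverage θs (testSet (σ.chosen.take k)) σ.chosen[k]

theorem allDouble_nil (D : Dataset S A R H) : AllDouble θs ⟨[], D⟩ :=
  fun k hk => absurd hk k.not_lt_zero

theorem AllDouble.append {σ : RunState S A R H} (hσ : AllDouble θs σ) {π : Policy S A H}
    (hπ : DoublesCoverage θs (testSet σ.chosen) π) (D : Dataset S A R H) :
    AllDouble θs ⟨σ.chosen ++ [π], D⟩ := by
  intro k hk
  rw [List.length_append, List.length_singleton, Nat.lt_succ_iff_lt_or_eq] at hk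
  rcases hk with h | rfl
  · rw [List.take_append_of_le_length h.le, List.getElem_append_left h]
    exact hσ k h
  · rwa [List.take_left, List.getElem_concat_length rfl]

open Classical in
/-- The scaled ratio sum, truncated at one, and one as soon as the coverage fails to double: a
supermartingale along the run whose mean bounds the probability of that failure. -/
noncomputable def failurePotential (Θ : Finset (LMDP S A R M)) (θs : LMDP S A R M) (d n : ℕ)
    (β : ℝ) (σ : RunState S A R H) : ℝ≥0∞ :=
  if AllDouble θs σ ∧ IsRecorded θs d n (testSet σ.chosen) σ.data then
    min 1 (scaledRatioSum Θ θs β σ.data)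
  else 1

theorem failurePotential_le_one (σ : RunState S A R H) : failurePotential Θ θs d n β σ ≤ 1 := by
  unfold failurePotential
  split_ifs
  exacts [min_le_left _ _, le_rfl]

theorem failurePotential_le_scaledRatioSum {σ : RunState S A R H} (hσ : AllDouble θs σ)
    (hrec : IsRecorded θs d n (testSet σ.chosen) σ.data) :
    failurePotential Θ θs d n β σ ≤ scaledRatioSum Θ θs β σ.data := by
  rw [failurePotential, if_pos ⟨hσ, hrec⟩]
  exact min_le_right _ _

variable {sel : RunState S A R H → PMF (Policy S A H)}

theorem pmfMean_iterate_failurePotential_le (hsel : IsSelectionRule Θ β ε sel)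
    (hdouble : ∀ (σ : RunState S A R H) (π : Policy S A H),
      IsRecorded θs d n (testSet σ.chosen) σ.data →
      (∀ θ ∈ Θ, dataRatio θs θ σ.data < Real.exp β) →
      IsDistinguishing Θ β ε σ π → DoublesCoverage θs (testSet σ.chosen) π)
    (σ : RunState S A R H) :
    pmfMean (iterate θs Θ d n β ε sel σ) (failurePotential Θ θs d n β) ≤
      failurePotential Θ θs d n β σ := by
  have hone : pmfMean (iterate θs Θ d n β ε sel σ) (failurePotential Θ θs d n β) ≤ 1 :=
    pmfMean_le fun σ' _ => failurePotential_le_one σ'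
  by_cases hdist : ∃ π, IsDistinguishing Θ β ε σ π
  swap
  · rw [iterate, if_neg hdist, pmfMean_pure]
  by_cases hσ : AllDouble θs σ ∧ IsRecorded θs d n (testSet σ.chosen) σ.data
  swap
  · rwa [failurePotential, if_neg hσ]
  obtain ⟨hall, hrec⟩ := hσ
  rw [failurePotential, if_pos ⟨hall, hrec⟩]
  refine le_min hone ?_
  rcases le_or_gt 1 (scaledRatioSum Θ θs β σ.data) with hlarge | hsmall
  · exact hone.trans hlarge
  rw [iterate, if_pos hdist, pmfMean_bind]
  refine pmfMean_le fun π hπ => ?_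
  have hπ_double := hdouble σ π hrec
    (fun θ => dataRatio_lt_exp_of_scaledRatioSum_lt_one hsmall) (hsel σ hdist π hπ)
  rw [pmfMean_map]
  exact (pmfMean_mono fun D hD => failurePotential_le_scaledRatioSum (hall.append hπ_double _)
    (hrec.append hD)).trans (pmfMean_scaledRatioSum_append_le _ _)

theorem pmfMean_runLaw_failurePotential_le (hsel : IsSelectionRule Θ β ε sel)
    (hdouble : ∀ (σ : RunState S A R H) (π : Policy S A H),
      IsRecorded θs d n (testSet σ.chosen) σ.data →
      (∀ θ ∈ Θ, dataRatio θs θ σ.data < Real.exp β) →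
      IsDistinguishing Θ β ε σ π → DoublesCoverage θs (testSet σ.chosen) π)
    (N : ℕ) :
    pmfMean (runLaw θs Θ d n β ε sel N) (failurePotential Θ θs d n β) ≤
      ENNReal.ofReal (Θ.card * Real.exp (-β)) := by
  induction N with
  | zero =>
    rw [runLaw, pmfMean_map, ← scaledRatioSum_nil]
    exact (pmfMean_mono fun D hD => failurePotential_le_scaledRatioSum (allDouble_nil D)
      (isRecorded_of_mem_support_execute_replicate hD)).trans
        (pmfMean_scaledRatioSum_append_le [] _)
  | succ N ih =>
    rw [runLaw, pmfMean_bind]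
    exact (pmfMean_mono fun σ _ => pmfMean_iterate_failurePotential_le hsel hdouble σ).trans ih

end Run

theorem mul_exp_neg_log_div_le {K c η : ℝ} (hK : 1 ≤ K) (hc : 0 < c) (hη : 0 < η) :
    c * Real.exp (-Real.log (K * c / η)) ≤ η := by
  rw [Real.exp_neg, Real.exp_log (by positivity), inv_div, mul_div_left_comm,
    div_mul_cancel_right₀ hc.ne']
  exact mul_le_of_le_one_right hη.le (inv_le_one_of_one_le₀ hK)

theorem LMDP.contexts_pos {S A R : Type*} {M : ℕ} (θ : LMDP S A R M) : 0 < M :=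
  θ.w.support_nonempty.elim fun m _ => m.pos

theorem lemma5_general {S A R : Type*} [Fintype S] [Fintype A] [Fintype R] [Nonempty A]
    {M H d n : ℕ} (hH : 2 ≤ H) (hd : 2 * M ≤ d + 1) {Θ : Finset (LMDP S A R M)}
    {θs : LMDP S A R M} (hθs : θs ∈ Θ) {ε η β : ℝ} (hε : 0 < ε)
    (hη : Θ.card * Real.exp (-β) ≤ η)
    (hn : 3 * β * (8 * H ^ 2) ^ d * (M * Fintype.card S ^ 2 * Fintype.card A ^ 2) ^ d / ε ^ 2 ≤
      (n : ℝ))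
    {sel : RunState S A R H → PMF (Policy S A H)} (hsel : IsSelectionRule Θ β ε sel) (N : ℕ) :
    ENNReal.ofReal (1 - η) ≤
      (runLaw θs Θ d n β ε sel N).toOuterMeasure {σ | AllDouble θs σ} := by
  have hfailure : pmfMean (runLaw θs Θ d n β ε sel N) (failurePotential Θ θs d n β) ≤
      ENNReal.ofReal η :=
    (pmfMean_runLaw_failurePotential_le hsel (fun _ _ hσ hr hπ =>
      hσ.doublesCoverage_of_isDistinguishing hH hd hθs hε hn hr hπ) N).trans
        (ENNReal.ofReal_le_ofReal hη)
  have hη₀ : 0 ≤ η := (by positivity : 0 ≤ Θ.card * Real.exp (-β)).trans hη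
  rw [ENNReal.ofReal_sub _ hη₀, ENNReal.ofReal_one, tsub_le_iff_right]
  refine (one_le_toOuterMeasure_add_pmfMean _ _ fun σ hσ => ?_).trans (add_le_add_right hfailure _)
  rw [failurePotential, if_neg fun h => hσ h.1]

theorem lemma5 {S A R : Type*} [Fintype S] [Fintype A] [Fintype R] [Nonempty A]
    {M H d : ℕ} (hH : 2 * M < H) (hd : d = 2 * M - 1)
    -- a finite class of models containing the true one
    (Θ : Finset (LMDP S A R M)) (θs : LMDP S A R M) (hθs : θs ∈ Θ)
    -- the inputs of the algorithm
    (K ntest : ℕ) (hK : 1 ≤ K) (ε η β : ℝ) (hε : 0 < ε) (hη : 0 < η)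
    (hβ : β = Real.log (K * Θ.card / η))
    (hn : 3 * β * M ^ 2 * (8 * H ^ 2) ^ d * (M * Fintype.card S ^ 2 * Fintype.card A ^ 2) ^ d
      / ε ^ 2 ≤ (ntest : ℝ))
    (sel : RunState S A R H → PMF (Policy S A H)) (hsel : IsSelectionRule Θ β ε sel) :
    -- the events below decrease with `N`, so this bounds the probability of their intersection
    ∀ N : ℕ, ENNReal.ofReal (1 - η) ≤
      (runLaw θs Θ d ntest β ε sel N).toOuterMeasure
        {σ | ∀ (k : ℕ) (hk : k < σ.chosen.length),
          DoublesCoverage θs (testSet (σ.chosen.take k)) σ.chosen[k]} := by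
  have hM : 0 < M := θs.contexts_pos
  have hcard : (0 : ℝ) < Θ.card := mod_cast Finset.card_pos.2 ⟨θs, hθs⟩
  exact lemma5_general (by omega) (by omega) hθs hε
    (hβ ▸ mul_exp_neg_log_div_le (mod_cast hK) hcard hη)
    (le_of_mul_le_of_one_le (hn.trans_eq' (by ring)) ntest.cast_nonneg
      (one_le_pow₀ (n := 2) (Nat.one_le_cast.2 hM))) hsel
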